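/- Let $\omega=e^{2\pi i/3}$, $\mathcal{E}=\mathbb{Z}[\omega]$ and $\theta=\omega-\bar\omega=\sqrt{-3}$, and identify $\mathcal{E}/\theta\mathcal{E}$ with $\mathbb{F}_3$. Equip $\mathbb{C}^{14}$ with the Hermitian form $\langle x,y\rangle=-x_0\bar y_0+x_1\bar y_1+\dots+x_{13}\bar y_{13}$, the last 13 coordinates being indexed by the points of the projective plane $P^2\mathbb{F}_3$. Let $\mathcal{C}\subseteq\mathbb{F}_3^{13}$ be the span of the differences of characteristic functions of lines of $P^2\mathbb{F}_3$, and let $\mathcal{C}^\perp$ be its orthogonal complement for the usual inner product. Let $L=L_{13,1}$ be the $\mathcal{E}$-lattice of all $(x_0;x_1,\dots,x_{13})\in\mathcal{E}^{14}$ such that $x_0\equiv x_1+\dots+x_{13}\pmod\theta$ and the reduction of $(x_1,\dots,x_{13})$ modulo $\theta$ lies in $\mathcal{C}^\perp$. The 13 point roots are the vectors $(0;\theta,0^{12})$, with $\theta$ in any of the last 13 coordinates; the 13 line roots are the vectors $(1;1^4,0^9)$, with the $1$'s along a line of $P^2\mathbb{F}_3$. For $r$ with $\langle r,r\rangle\neq0$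 and $\zeta$ a root of unity, the $\zeta$-reflection in $r$ is $x\mapsto x+(\zeta-1)\frac{\langle x,r\rangle}{\langle r,r\rangle}r$; the triflections in $r$ are the $\zeta$-reflections with $\zeta$ of order 3. Let $\Delta$ be the incidence graph of the points and lines of $P^2\mathbb{F}_3$, and let $Y_{555}$ be the tree with 16 nodes consisting of a central node and three arms of five nodes each. The graph $Y_{555}$ embeds in $\Delta$ as an induced subgraph. For every such embedding, let $R$ be the group generated by the $\omega$-reflections in the 16 point and line roots that correspond to the nodes of $Y_{555}$. Then these 16 roots span $L$ over $\mathcal{E}$; the group $R$ contains the triflections in all 26 point and line roots; and $R$ contains the group $L_3(3)=\mathrm{PSL}_3(\mathbb{F}_3)$, acting on $\mathbb{C}^{14}$ by permuting the last 13 coordinates as it permutes the points of $P^2\mathbb{F}_3$. -/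

import Mathlib

noncomputable section

namespace Y555

open scoped LinearAlgebra.Projectivization MatrixGroups

/-- The primitive cube root of unity `ω = (-1 + √-3) / 2`. -/
def ω : ℂ := (-1 + (Real.sqrt 3 : ℂ) * Complex.I) / 2

theorem ω_sq : ω ^ 2 = -1 - ω := by
  have h : (Real.sqrt 3 : ℂ) ^ 2 = 3 := by
    rw [← Complex.ofReal_pow, Real.sq_sqrt (by norm_num)]; norm_num
  unfold ω
  linear_combination (1 / 4) * (Complex.I ^ 2) * h + (3 / 4) * Complex.I_sq

theorem ω_ne_zero : ω ≠ 0 := by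
  intro h
  have := ω_sq
  rw [h] at this
  norm_num at this

/-- `ω` as a unit of `ℂ`. -/
def ωUnit : ℂˣ := Units.mk0 ω ω_ne_zero

/-- `θ = ω - conj ω = √-3`. -/
def θ : ℂ := ω - (starRingEnd ℂ) ω

theorem θ_eq : θ = 1 + 2 * ω := by
  unfold θ ω
  simp only [map_div₀, map_add, map_neg, map_one, map_mul, Complex.conj_ofReal, Complex.conj_I,
    map_ofNat]
  ring

/-- The Eisenstein integers `ℤ[ω] = {a + b ω | a b : ℤ}`, as a subring of `ℂ`. -/
def Eis : Subring ℂ where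
  carrier := {z | ∃ a b : ℤ, z = a + b * ω}
  zero_mem' := ⟨0, 0, by simp⟩
  one_mem' := ⟨1, 0, by simp⟩
  add_mem' := by
    rintro _ _ ⟨a, b, rfl⟩ ⟨c, d, rfl⟩
    exact ⟨a + c, b + d, by push_cast; ring⟩
  neg_mem' := by
    rintro _ ⟨a, b, rfl⟩
    exact ⟨-a, -b, by push_cast; ring⟩
  mul_mem' := by
    rintro _ _ ⟨a, b, rfl⟩ ⟨c, d, rfl⟩
    refine ⟨a * c - b * d, a * d + b * c - b * d, ?_⟩
    push_cast
    linear_combination (b * d : ℂ) * ω_sq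

theorem θ_mem : θ ∈ Eis := ⟨1, 2, by rw [θ_eq]; push_cast; ring⟩

/-- Congruence modulo `θ` in `ℤ[ω]`: `x ≡ y` when `x - y ∈ θ ℤ[ω]`. -/
def CongrTheta (x y : ℂ) : Prop := ∃ e ∈ Eis, x - y = θ * e

theorem CongrTheta.add {x y x' y' : ℂ} (h : CongrTheta x y) (h' : CongrTheta x' y') :
    CongrTheta (x + x') (y + y') := by
  obtain ⟨e, he, h⟩ := h
  obtain ⟨e', he', h'⟩ := h'
  exact ⟨e + e', Eis.add_mem he he', by linear_combination h + h'⟩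

theorem CongrTheta.mul_left {x y c : ℂ} (hc : c ∈ Eis) (h : CongrTheta x y) :
    CongrTheta (c * x) (c * y) := by
  obtain ⟨e, he, h⟩ := h
  exact ⟨c * e, Eis.mul_mem hc he, by linear_combination c * h⟩

theorem CongrTheta.trans {x y z : ℂ} (h : CongrTheta x y) (h' : CongrTheta y z) :
    CongrTheta x z := by
  obtain ⟨e, he, h⟩ := h
  obtain ⟨e', he', h'⟩ := h'
  exact ⟨e + e', Eis.add_mem he he', by linear_combination h + h'⟩

/-- Integers that agree modulo `3` are congruent modulo `θ`. -/
theorem congrTheta_intCast {m n : ℤ} (h : (m : ZMod 3) = n) : CongrTheta m n := by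
  obtain ⟨k, hk⟩ := (ZMod.intCast_eq_intCast_iff_dvd_sub n m 3).1 h.symm
  have hk' : (m : ℂ) - n = 3 * k := by exact_mod_cast hk
  refine ⟨-θ * k, Eis.mul_mem (Eis.neg_mem θ_mem) (intCast_mem Eis k), ?_⟩
  rw [θ_eq]
  linear_combination hk' + 4 * (k : ℂ) * ω_sq

/-- Every Eisenstein integer `a + b ω` is congruent to the integer `a + b` modulo `θ`. -/
theorem exists_int_congrTheta {c : ℂ} (hc : c ∈ Eis) : ∃ n : ℤ, CongrTheta c n := by
  obtain ⟨a, b, rfl⟩ := hc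
  refine ⟨a + b, b * (1 + ω), ⟨b, b, by ring⟩, ?_⟩
  rw [θ_eq]
  push_cast
  linear_combination (-2 * (b : ℂ)) * ω_sq

/-! ### The projective plane over `𝔽₃` and its codes -/

/-- The points of `P²(𝔽₃)`. -/
abbrev Point : Type := ℙ (ZMod 3) (Fin 3 → ZMod 3)

/-- The lines of `P²(𝔽₃)`, in homogeneous line coordinates: `l` stands for the line
`{p | p ⬝ l = 0}`. -/
abbrev Line : Type := ℙ (ZMod 3) (Fin 3 → ZMod 3)

instance : Fintype Point := Fintype.ofFinite _

/-- The set of points on a line. -/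
def pointsOn (l : Line) : Set Point := {p | Projectivization.orthogonal p l}

/-- The characteristic function of a line, in `𝔽₃¹³`. -/
def lineWord (l : Line) : Point → ZMod 3 := (pointsOn l).indicator 1

/-- The line difference code `𝒞`, spanned by the differences of lines. -/
def lineDiffCode : Submodule (ZMod 3) (Point → ZMod 3) :=
  Submodule.span (ZMod 3) {w | ∃ l m : Line, w = lineWord l - lineWord m}

/-- The line code `𝒞^⊥`, the orthogonal complement of `𝒞` for the usual inner product. -/
def lineCode : Submodule (ZMod 3) (Point → ZMod 3) where
  carrier := {w | ∀ c ∈ lineDiffCode, ∑ p, w p * c p = 0}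
  zero_mem' := by
    intro c _
    simp
  add_mem' := by
    intro v w hv hw c hc
    simp only [Pi.add_apply, add_mul, Finset.sum_add_distrib, hv c hc, hw c hc, add_zero]
  smul_mem' := by
    intro a w hw c hc
    simp only [Pi.smul_apply, smul_eq_mul, mul_assoc, ← Finset.mul_sum, hw c hc, mul_zero]

/-! ### The Hermitian space `ℂ^{13,1}` and the lattice `L` -/

/-- `ℂ¹⁴`, with vectors `(x₀; x₁, …, x₁₃)`, the last 13 coordinates being indexed by the points
of `P²(𝔽₃)`. -/
abbrev V : Type := ℂ × (Point → ℂ)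

/-- The Hermitian form of signature `(13, 1)`, linear in the first argument:
`⟨x, y⟩ = -x₀ conj y₀ + x₁ conj y₁ + ⋯ + x₁₃ conj y₁₃`. -/
def herm (x y : V) : ℂ :=
  -(x.1 * (starRingEnd ℂ) y.1) + ∑ p, x.2 p * (starRingEnd ℂ) (y.2 p)

theorem herm_add_left (x y z : V) : herm (x + y) z = herm x z + herm y z := by
  simp only [herm, Prod.fst_add, Prod.snd_add, Pi.add_apply, add_mul, Finset.sum_add_distrib]
  ring

theorem herm_smul_left (a : ℂ) (x z : V) : herm (a • x) z = a * herm x z := by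
  simp only [herm, Prod.smul_fst, Prod.smul_snd, Pi.smul_apply, smul_eq_mul, mul_assoc,
    ← Finset.mul_sum]
  ring

/-- The lattice `L = L_{13,1}`: the vectors `(x₀; x₁, …, x₁₃)` over `ℤ[ω]` such that
`x₀ ≡ x₁ + ⋯ + x₁₃` modulo `θ` and the reduction of `(x₁, …, x₁₃)` modulo `θ` lies in `𝒞^⊥`.
Here `ℤ[ω]/θ` is identified with `𝔽₃`, so the reduction of `(x₁, …, x₁₃)` is the word `c` over
`𝔽₃` whose integer representatives are congruent to the `xᵢ` modulo `θ`. -/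
def L : Submodule Eis V where
  carrier := {x | x.1 ∈ Eis ∧ (∀ p, x.2 p ∈ Eis) ∧ CongrTheta x.1 (∑ p, x.2 p) ∧
    ∃ c ∈ lineCode, ∀ p, CongrTheta (x.2 p) ((c p).val : ℂ)}
  zero_mem' := by
    refine ⟨Eis.zero_mem, fun _ => Eis.zero_mem, ⟨0, Eis.zero_mem, by simp⟩, 0,
      lineCode.zero_mem, fun _ => ⟨0, Eis.zero_mem, by simp⟩⟩
  add_mem' := by
    rintro x y ⟨h1, h2, h3, c, hc, h4⟩ ⟨k1, k2, k3, d, hd, k4⟩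
    refine ⟨Eis.add_mem h1 k1, fun p => Eis.add_mem (h2 p) (k2 p), ?_, c + d,
      lineCode.add_mem hc hd, fun p => ?_⟩
    · simpa only [Prod.fst_add, Prod.snd_add, Pi.add_apply, Finset.sum_add_distrib]
        using h3.add k3
    · refine ((h4 p).add (k4 p)).trans ?_
      have := congrTheta_intCast (m := ((c p).val + (d p).val : ℕ))
        (n := (((c + d) p).val : ℕ)) (by simp)
      exact_mod_cast this
  smul_mem' := by
    rintro ⟨e, he⟩ x ⟨h1, h2, h3, c, hc, h4⟩
    obtain ⟨n, hn⟩ := exists_int_congrTheta he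
    refine ⟨Eis.mul_mem he h1, fun p => Eis.mul_mem he (h2 p), ?_, (n : ZMod 3) • c,
      lineCode.smul_mem _ hc, fun p => ?_⟩
    · have := h3.mul_left he
      rw [Finset.mul_sum] at this
      exact this
    · have hv : (((c p).val : ℕ) : ℂ) ∈ Eis := natCast_mem Eis _
      have h5 := hn.mul_left hv
      rw [mul_comm, mul_comm _ (n : ℂ)] at h5
      refine ((h4 p).mul_left he).trans (h5.trans ?_)
      have := congrTheta_intCast (m := n * ((c p).val : ℕ))
        (n := ((((n : ZMod 3) • c) p).val : ℕ)) (by simp)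
      exact_mod_cast this

/-! ### Point roots, line roots and their reflections -/

open Classical in
/-- The point root `(0; θ, 0¹²)` with `θ` in the position of `p`. -/
def pointRoot (p : Point) : V := (0, Pi.single p θ)

/-- The line root `(1; 1⁴, 0⁹)` with the `1`s along the line `l`. -/
def lineRoot (l : Line) : V := (1, (pointsOn l).indicator 1)

/-- The 26 point and line roots, indexed by the points and lines of `P²(𝔽₃)`. -/
def root : Point ⊕ Line → V := Sum.elim pointRoot lineRoot

/-- The linear map `x ↦ x + (ζ - 1) (⟨x, r⟩ / ⟨r, r⟩) r`: for `⟨r, r⟩ ≠ 0` it multiplies `r` by `ζ`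
and fixes the orthogonal complement of `r` pointwise. -/
def reflectionMap (ζ : ℂ) (r : V) : V →ₗ[ℂ] V where
  toFun x := x + ((ζ - 1) * (herm x r / herm r r)) • r
  map_add' x y := by
    rw [herm_add_left]
    module
  map_smul' a x := by
    rw [herm_smul_left, RingHom.id_apply]
    module

theorem reflectionMap_comp (ζ ξ : ℂ) (h : ζ * ξ = 1) (r x : V) :
    reflectionMap ζ r (reflectionMap ξ r x) = x := by
  simp only [reflectionMap, LinearMap.coe_mk, AddHom.coe_mk, herm_add_left, herm_smul_left]
  by_cases hr : herm r r = 0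
  · simp [hr]
  · have : (herm x r + (ξ - 1) * (herm x r / herm r r) * herm r r) / herm r r
        = ξ * (herm x r / herm r r) := by
      field_simp
      ring
    rw [this, add_assoc, ← add_smul]
    have h0 : (ξ - 1) * (herm x r / herm r r) + (ζ - 1) * (ξ * (herm x r / herm r r)) = 0 := by
      linear_combination (herm x r / herm r r) * h
    rw [h0, zero_smul, add_zero]

/-- The `ζ`-reflection in `r`, as an element of `GL(V)`. For a root `r` and `ζ` of order 3 this is a
triflection in `r`. -/
def reflection (ζ : ℂˣ) (r : V) : V ≃ₗ[ℂ] V where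
  __ := reflectionMap ζ r
  invFun := reflectionMap (ζ⁻¹ : ℂˣ) r
  left_inv x := reflectionMap_comp _ _ (by simp) r x
  right_inv x := reflectionMap_comp _ _ (by simp) r x

/-! ### The action of `L₃(3)` -/

/-- The action of `L₃(3) = PSL(3, 𝔽₃)` on `V` that permutes the last 13 coordinates as it permutes
the points of `P²(𝔽₃)`. -/
def permAction : PSL(3, ZMod 3) →* (V ≃ₗ[ℂ] V) where
  toFun g :=
    { toFun := fun x => (x.1, fun p => x.2 (g⁻¹ • p))
      invFun := fun x => (x.1, fun p => x.2 (g • p))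
      map_add' := fun _ _ => rfl
      map_smul' := fun _ _ => rfl
      left_inv := fun x => by simp
      right_inv := fun x => by simp }
  map_one' := by
    ext x <;> simp
  map_mul' g h := by
    ext x <;> simp [mul_smul]

/-- The copy of `L₃(3)` in `GL(V)` that permutes the coordinates. -/
def L33 : Subgroup (V ≃ₗ[ℂ] V) := permAction.range

/-! ### The incidence graph and the `Y₅₅₅` diagram -/

/-- The incidence graph `Δ` of the points and lines of `P²(𝔽₃)`. -/
def incidenceGraph : SimpleGraph (Point ⊕ Line) where
  Adj u v := (∃ p l, p ∈ pointsOn l ∧ u = Sum.inl p ∧ v = Sum.inr l) ∨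
    (∃ p l, p ∈ pointsOn l ∧ v = Sum.inl p ∧ u = Sum.inr l)
  symm := ⟨fun _ _ h => h.symm⟩
  loopless := ⟨by
    rintro u (⟨p, l, _, h, h'⟩ | ⟨p, l, _, h, h'⟩) <;>
    · rw [h] at h'
      cases h'⟩

/-- The `Y₅₅₅` diagram: a central node `none` and three arms of five nodes each, `some (a, i)` being
the node at distance `i + 1` from the center on the arm `a`. -/
def diagram : SimpleGraph (Option (Fin 3 × Fin 5)) :=
  SimpleGraph.fromRel fun u v =>
    (∃ a, u = none ∧ v = some (a, 0)) ∨
    (∃ a : Fin 3, ∃ i j : Fin 5, j.val = i.val + 1 ∧ u = some (a, i) ∧ v = some (a, j))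

/-- The group `R` generated by the `ω`-reflections in the 16 roots of a `Y₅₅₅` diagram in `Δ`. -/
def R (f : diagram ↪g incidenceGraph) : Subgroup (V ≃ₗ[ℂ] V) :=
  Subgroup.closure (Set.range fun i => reflection ωUnit (root (f i)))

end Y555

end

/-! Every `Y₅₅₅` diagram in `Δ` is the image of a standard one under an automorphism of `Δ`. The
span of the roots of an induced `12`-gon contains a vector of negative norm, so the isotropic
vector `∑ (-ω) ^ i g i` formed from the suitably signed roots `g i`, which is orthogonal to all of
them, vanishes. Hence each root of a `12`-gon lies in the `ℤ[ω]`-span of the other eleven, and its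
reflection is conjugate to one of theirs by a Coxeter element. Completing `12`-gons leads from the
nodes of `Y₅₅₅` to all of `Δ`, which gives the 26 triflections, and, since words of the line code
are combinations of lines, also the lattice.

The Garside element of a chain of five roots reverses the chain up to scalars. For the two chains
cut out of a `12`-gon by a pair of opposite nodes, the quotient of these elements is an isometry
that reverses the `12`-gon, and it permutes the coordinates of `ℂ¹⁴` as a transposition of the
homogeneous coordinates permutes the points. The normal closure of such transpositions in
`SL₃(𝔽₃)` is everything, because iterated commutators with them yield the transvections. -/

noncomputable section

namespace Y555

open scoped LinearAlgebra.Projectivization MatrixGroups ComplexConjugate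
open Matrix

/-! ### Automorphisms of the incidence graph -/

theorem orthogonal_iff_rep_dotProduct_rep {K n : Type*} [Field K] [Fintype n]
    (p q : ℙ K (n → K)) : p.orthogonal q ↔ p.rep ⬝ᵥ q.rep = 0 := by
  rw [← Projectivization.orthogonal_mk p.rep_nonzero q.rep_nonzero, p.mk_rep, q.mk_rep]

theorem exists_mulVec_eq_of_mul_eq_diagonal {K n : Type*} [Field K] [Fintype n] [DecidableEq n]
    {U B : Matrix n n K} {d y : n → K} (hUB : U * B = diagonal d) (hd : ∀ a, d a ≠ 0)
    (hy : ∀ a, (U *ᵥ y) a ≠ 0) : ∃ c, (B * diagonal c).det ≠ 0 ∧ B *ᵥ c = y := by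
  have hB : B.det ≠ 0 := right_ne_zero_of_mul (a := U.det) <| by
    rw [← det_mul, hUB, det_diagonal]
    exact Finset.prod_ne_zero_iff.2 fun a _ => hd a
  obtain ⟨c, rfl⟩ : ∃ c, B *ᵥ c = y :=
    ⟨B⁻¹ *ᵥ y, by rw [mulVec_mulVec, mul_nonsing_inv _ hB.isUnit, one_mulVec]⟩
  have hc (a : n) : c a ≠ 0 := fun h => hy a <| by
    rw [mulVec_mulVec, hUB, mulVec_diagonal, h, mul_zero]
  exact ⟨c, by simpa [hB, Finset.prod_eq_zero_iff] using hc, rfl⟩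

theorem exists_smul_frame {K n : Type*} [Field K] [Fintype n] [DecidableEq n] [Nonempty n]
    {x j : n → ℙ K (n → K)} {y : ℙ K (n → K)}
    (hx : ∀ a b, Projectivization.orthogonal (x a) (j b) ↔ a ≠ b)
    (hy : ∀ b, ¬ Projectivization.orthogonal y (j b)) :
    ∃ g : GL n K, (∀ a, g • Projectivization.mk K (Pi.single a 1) (by simp) = x a) ∧
      g • Projectivization.mk K (1 : n → K) one_ne_zero = y := by
  simp only [orthogonal_iff_rep_dotProduct_rep] at hx hy
  let A : Matrix n n K := of fun a => (x a).rep
  let U : Matrix n n K := of fun b => (j b).rep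
  have hUA : U * Aᵀ = diagonal fun a => (x a).rep ⬝ᵥ (j a).rep := by
    ext b a
    rw [mul_apply, diagonal_apply]
    split_ifs with h
    · rw [h]
      exact dotProduct_comm _ _
    · exact (dotProduct_comm _ _).trans ((hx a b).2 (Ne.symm h))
  obtain ⟨c, hB, hc⟩ := exists_mulVec_eq_of_mul_eq_diagonal (y := y.rep) hUA
    (fun a h => (hx a a).1 h rfl) fun a h => hy a ((dotProduct_comm _ _).trans h)
  refine ⟨GeneralLinearGroup.mkOfDetNeZero _ hB, fun a => ?_, ?_⟩
  · rw [Projectivization.smul_mk, ← (x a).mk_rep, Projectivization.mk_eq_mk_iff']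
    refine ⟨c a, .symm ?_⟩
    change (Aᵀ * diagonal c) *ᵥ Pi.single a 1 = c a • (x a).rep
    ext i
    simp [A, mul_comm]
  · rw [Projectivization.smul_mk, ← y.mk_rep, Projectivization.mk_eq_mk_iff']
    refine ⟨1, .symm ?_⟩
    change (Aᵀ * diagonal c) *ᵥ 1 = (1 : K) • y.rep
    rw [one_smul, ← mulVec_mulVec, ← hc]
    congr 1
    ext i
    simp [mulVec_diagonal]

/-- The inverse transpose of an invertible matrix, through which collineations act on lines. -/
def contragredient (g : GL (Fin 3) (ZMod 3)) : GL (Fin 3) (ZMod 3) where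
  val := (g⁻¹).1ᵀ
  inv := g.1ᵀ
  val_inv := by rw [← transpose_mul, ← Units.val_mul]; simp
  inv_val := by rw [← transpose_mul, ← Units.val_mul]; simp

theorem mem_pointsOn_mk {v w : Fin 3 → ZMod 3} (hv : v ≠ 0) (hw : w ≠ 0) :
    (.mk (ZMod 3) v hv : Point) ∈ pointsOn (.mk (ZMod 3) w hw) ↔ v ⬝ᵥ w = 0 :=
  Projectivization.orthogonal_mk hv hw

theorem mem_pointsOn_comm {p l : Point} : p ∈ pointsOn l ↔ l ∈ pointsOn p :=
  Projectivization.orthogonal_comm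

theorem smul_mem_pointsOn_smul (g : GL (Fin 3) (ZMod 3)) (p l : Point) :
    g • p ∈ pointsOn (contragredient g • l) ↔ p ∈ pointsOn l := by
  induction p using Projectivization.ind with | _ v hv =>
  induction l using Projectivization.ind with | _ w hw =>
  rw [Projectivization.smul_mk, Projectivization.smul_mk, mem_pointsOn_mk, mem_pointsOn_mk]
  have : (g • v) ⬝ᵥ (contragredient g • w) = v ⬝ᵥ w := by
    change (g.1 *ᵥ v) ⬝ᵥ ((g⁻¹).1ᵀ *ᵥ w) = v ⬝ᵥ w
    rw [dotProduct_mulVec, vecMul_transpose, mulVec_mulVec, ← Units.val_mul]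
    simp
  rw [this]

@[simp]
theorem incidenceGraph_adj_inl_inr {p : Point} {l : Line} :
    incidenceGraph.Adj (.inl p) (.inr l) ↔ p ∈ pointsOn l := by
  simp [incidenceGraph]

@[simp]
theorem incidenceGraph_adj_inr_inl {p : Point} {l : Line} :
    incidenceGraph.Adj (.inr l) (.inl p) ↔ p ∈ pointsOn l := by
  simp [incidenceGraph]

@[simp]
theorem incidenceGraph_not_adj_inl_inl {p q : Point} :
    ¬ incidenceGraph.Adj (.inl p) (.inl q) := by
  simp [incidenceGraph]

@[simp]
theorem incidenceGraph_not_adj_inr_inr {l m : Line} :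
    ¬ incidenceGraph.Adj (.inr l) (.inr m) := by
  simp [incidenceGraph]

/-- The polarity that exchanges points and lines with the same homogeneous coordinates. -/
def polarity : incidenceGraph ≃g incidenceGraph where
  toEquiv := Equiv.sumComm _ _
  map_rel_iff' := by
    rintro (i | i) (j | j) <;> simp [mem_pointsOn_comm]

/-- The automorphism of the incidence graph defined by an invertible matrix. -/
def collineation (g : GL (Fin 3) (ZMod 3)) : incidenceGraph ≃g incidenceGraph where
  toEquiv := Equiv.sumCongr (MulAction.toPerm g) (MulAction.toPerm (contragredient g))
  map_rel_iff' := by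
    rintro (i | i) (j | j) <;> simp [smul_mem_pointsOn_smul]

theorem eq_or_eq_of_mem_pointsOn {p q : Point} {l m : Line} (hpl : p ∈ pointsOn l)
    (hql : q ∈ pointsOn l) (hpm : p ∈ pointsOn m) (hqm : q ∈ pointsOn m) : p = q ∨ l = m :=
  Configuration.Nondegenerate.eq_or_eq (P := Point) (L := Line) hpl hql hpm hqm

theorem exists_mem_pointsOn {p q : Point} (h : p ≠ q) :
    ∃ l : Line, p ∈ pointsOn l ∧ q ∈ pointsOn l :=
  ⟨p.cross q, Projectivization.orthogonal_cross_left h, Projectivization.orthogonal_cross_right h⟩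

/-! ### Uniqueness of the `Y₅₅₅` diagram up to automorphisms -/

/-- The nonzero vectors, as homogeneous coordinates of points and of lines. -/
abbrev NonzeroVec : Type := {v : Fin 3 → ZMod 3 // v ≠ 0}

/-- The coordinates `(1, 1, 1)` of the center of the standard `Y₅₅₅` diagram. -/
def ones : NonzeroVec := ⟨1, by decide⟩

/-- The `a`-th coordinate vector. -/
def unitVec (a : Fin 3) : NonzeroVec := ⟨Pi.single a 1, by revert a; decide⟩

/-- The coordinates `e b - e c`, where `b = a + 1` and `c = a + 2` modulo `3`. -/
def diffVec (a : Fin 3) : NonzeroVec :=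
  ⟨Pi.single (a + 1) 1 - Pi.single (a + 2) 1, by revert a; decide⟩

/-- The coordinates `e b + e c`, where `b = a + 1` and `c = a + 2` modulo `3`. -/
def sumVec (a : Fin 3) : NonzeroVec := ⟨1 - Pi.single a 1, by revert a; decide⟩

/-- The coordinates `2 e a + e b + e c`, that is `e b + e c - e a` over `𝔽₃`, where `b = a + 1` and
`c = a + 2` modulo `3`. -/
def signVec (a : Fin 3) : NonzeroVec := ⟨1 + Pi.single a 1, by revert a; decide⟩

/-- The point, or the line, with given homogeneous coordinates. -/
def proj (v : NonzeroVec) : Point := Projectivization.mk' (ZMod 3) v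

theorem proj_mem_pointsOn_proj {v w : NonzeroVec} :
    proj v ∈ pointsOn (proj w) ↔ v.1 ⬝ᵥ w.1 = 0 :=
  mem_pointsOn_mk v.2 w.2

theorem proj_eq_proj_iff {v w : NonzeroVec} : proj v = proj w ↔ v.1 = w.1 ∨ v.1 = -w.1 := by
  refine (Projectivization.mk_eq_mk_iff' ..).trans ?_
  obtain ⟨v, hv⟩ := v
  obtain ⟨w, hw⟩ := w
  revert v w
  decide +kernel

theorem exists_proj_eq (p : Point) : ∃ v, proj v = p :=
  p.ind fun v hv => ⟨⟨v, hv⟩, rfl⟩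

/-- The point or line with given homogeneous coordinates, as a node of the incidence graph. -/
def node : NonzeroVec ⊕ NonzeroVec → Point ⊕ Line := Sum.map proj proj

theorem node_adj_node {v w : NonzeroVec ⊕ NonzeroVec} :
    incidenceGraph.Adj (node v) (node w) ↔
      v.isLeft ≠ w.isLeft ∧ v.elim (·.1) (·.1) ⬝ᵥ w.elim (·.1) (·.1) = 0 := by
  rcases v with v | v <;> rcases w with w | w <;>
    simp [node, proj_mem_pointsOn_proj, dotProduct_comm]

instance (v w : NonzeroVec ⊕ NonzeroVec) : Decidable (incidenceGraph.Adj (node v) (node w)) :=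
  decidable_of_iff' _ node_adj_node

/-- The nodes of a `Y₅₅₅` diagram centred at the point `p`, the arm `a` being
`l a`, `q a`, `m a`, `s a`, `n a` from the center outwards. -/
def nodes {α β : Type*} (p : α) (l : Fin 3 → β) (q : Fin 3 → α) (m : Fin 3 → β) (s : Fin 3 → α)
    (n : Fin 3 → β) : Option (Fin 3 × Fin 5) → α ⊕ β
  | none => .inl p
  | some (a, 0) => .inr (l a)
  | some (a, 1) => .inl (q a)
  | some (a, 2) => .inr (m a)
  | some (a, 3) => .inl (s a)
  | some (a, 4) => .inr (n a)

@[simp]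
theorem diagram_adj_none_some {a : Fin 3} {i : Fin 5} :
    diagram.Adj none (some (a, i)) ↔ i = 0 := by
  simp [diagram]

@[simp]
theorem diagram_adj_some_some {a b : Fin 3} {i j : Fin 5} :
    diagram.Adj (some (a, i)) (some (b, j)) ↔
      a = b ∧ (j.val = i.val + 1 ∨ i.val = j.val + 1) := by
  simp only [diagram, SimpleGraph.fromRel_adj]
  grind

/-- The incidences of the points and lines that form an induced `Y₅₅₅` diagram centred at the point
`p`, labelled as in `nodes`. -/
structure PointCentered (p : Point) (l : Fin 3 → Line) (q : Fin 3 → Point) (m : Fin 3 → Line)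
    (s : Fin 3 → Point) (n : Fin 3 → Line) : Prop where
  p_mem_l (a) : p ∈ pointsOn (l a)
  p_notMem_m (a) : p ∉ pointsOn (m a)
  p_notMem_n (a) : p ∉ pointsOn (n a)
  q_mem_l {a b} : q a ∈ pointsOn (l b) ↔ a = b
  q_mem_m {a b} : q a ∈ pointsOn (m b) ↔ a = b
  q_notMem_n (a b) : q a ∉ pointsOn (n b)
  s_notMem_l (a b) : s a ∉ pointsOn (l b)
  s_mem_m {a b} : s a ∈ pointsOn (m b) ↔ a = b
  s_mem_n {a b} : s a ∈ pointsOn (n b) ↔ a = b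

theorem pointCentered_of_adj_iff {p : Point} {l : Fin 3 → Line} {q : Fin 3 → Point}
    {m : Fin 3 → Line} {s : Fin 3 → Point} {n : Fin 3 → Line}
    (h : ∀ i j, incidenceGraph.Adj (nodes p l q m s n i) (nodes p l q m s n j) ↔
      diagram.Adj i j) : PointCentered p l q m s n := by
  have mem_iff (i j) {x y} (hi : nodes p l q m s n i = .inl x) (hj : nodes p l q m s n j = .inr y) :
      x ∈ pointsOn y ↔ diagram.Adj i j := by
    rw [← incidenceGraph_adj_inl_inr, ← hi, ← hj, h]
  have p_mem (a k) {y} (hy : nodes p l q m s n (some (a, k)) = .inr y) : p ∈ pointsOn y ↔ k = 0 :=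
    (mem_iff none _ rfl hy).trans diagram_adj_none_some
  have q_mem (a b k) {y} (hy : nodes p l q m s n (some (b, k)) = .inr y) :=
    (mem_iff (some (a, 1)) _ rfl hy).trans diagram_adj_some_some
  have s_mem (a b k) {y} (hy : nodes p l q m s n (some (b, k)) = .inr y) :=
    (mem_iff (some (a, 3)) _ rfl hy).trans diagram_adj_some_some
  exact
    { p_mem_l := fun a => (p_mem a 0 rfl).2 rfl
      p_notMem_m := fun a => (p_mem a 2 rfl).not.2 (by decide)
      p_notMem_n := fun a => (p_mem a 4 rfl).not.2 (by decide)
      q_mem_l := fun {a b} => (q_mem a b 0 rfl).trans (by simp)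
      q_mem_m := fun {a b} => (q_mem a b 2 rfl).trans (by simp)
      q_notMem_n := fun a b => (q_mem a b 4 rfl).not.2 (by simp)
      s_notMem_l := fun a b => (s_mem a b 0 rfl).not.2 (by simp)
      s_mem_m := fun {a b} => (s_mem a b 2 rfl).trans (by simp)
      s_mem_n := fun {a b} => (s_mem a b 4 rfl).trans (by simp) }

theorem exists_eq_nodes (f : diagram ↪g incidenceGraph) {p : Point} (hp : f none = .inl p) :
    ∃ l q m s n, ⇑f = nodes p l q m s n := by
  have inl_of {i j} (h : diagram.Adj i j) : (∃ p, f i = .inl p) → ∃ l, f j = .inr l := by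
    rintro ⟨p, hp⟩
    have := f.map_adj_iff.2 h
    rw [hp] at this
    cases hj : f j <;> simp_all
  have inr_of {i j} (h : diagram.Adj i j) : (∃ l, f i = .inr l) → ∃ p, f j = .inl p := by
    rintro ⟨p, hp⟩
    have := f.map_adj_iff.2 h
    rw [hp] at this
    cases hj : f j <;> simp_all
  have hl (a : Fin 3) := inl_of (j := some (a, 0)) (by simp) ⟨p, hp⟩
  have hq (a : Fin 3) := inr_of (j := some (a, 1)) (by simp) (hl a)
  have hm (a : Fin 3) := inl_of (j := some (a, 2)) (by simp) (hq a)
  have hs (a : Fin 3) := inr_of (j := some (a, 3)) (by simp) (hm a)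
  have hn (a : Fin 3) := inl_of (j := some (a, 4)) (by simp) (hs a)
  choose l hl using hl
  choose q hq using hq
  choose m hm using hm
  choose s hs using hs
  choose n hn using hn
  refine ⟨l, q, m, s, n, ?_⟩
  funext i
  rcases i with - | ⟨a, j⟩
  · exact hp
  · fin_cases j
    exacts [hl a, hq a, hm a, hs a, hn a]

instance : DecidableRel diagram.Adj := by
  unfold diagram
  infer_instance

/-- A `Y₅₅₅` diagram with threefold symmetry, of which every other one is an image. -/
def standardNodes (i : Option (Fin 3 × Fin 5)) : Point ⊕ Line :=
  node (nodes ones diffVec unitVec sumVec diffVec signVec i)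

theorem standardNodes_eq : standardNodes =
    nodes (proj ones) (fun a => proj (diffVec a)) (fun a => proj (unitVec a))
      (fun a => proj (sumVec a)) (fun a => proj (diffVec a)) (fun a => proj (signVec a)) := by
  funext i
  rcases i with - | ⟨a, j⟩
  · rfl
  · fin_cases j <;> rfl

theorem standardNodes_adj (i j : Option (Fin 3 × Fin 5)) :
    incidenceGraph.Adj (standardNodes i) (standardNodes j) ↔ diagram.Adj i j := by
  unfold standardNodes
  revert i j
  decide +kernel

theorem exists_smul_frame_of_path {q₀ p q₁ s : Point} {l₀ l₁ m : Line} (hpl₀ : p ∈ pointsOn l₀)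
    (hpl₁ : p ∈ pointsOn l₁) (hql₀ : q₀ ∈ pointsOn l₀) (hql₁ : q₁ ∈ pointsOn l₁)
    (hqm : q₀ ∈ pointsOn m) (hsm : s ∈ pointsOn m) (hq₀ : q₀ ∉ pointsOn l₁)
    (hq₁ : q₁ ∉ pointsOn l₀) (hq₁m : q₁ ∉ pointsOn m) (hs₀ : s ∉ pointsOn l₀)
    (hs₁ : s ∉ pointsOn l₁) :
    ∃ g : GL (Fin 3) (ZMod 3), g • proj (unitVec 0) = q₀ ∧ g • proj (unitVec 1) = p ∧
      g • proj (unitVec 2) = q₁ ∧ g • proj ones = s := by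
  obtain ⟨k, hk₀, hk₁⟩ := exists_mem_pointsOn (p := q₀) (q := q₁) fun h => hq₁ (h ▸ hql₀)
  have hpk : p ∉ pointsOn k := fun h => by
    rcases eq_or_eq_of_mem_pointsOn hpl₀ hql₀ h hk₀ with rfl | rfl
    exacts [hq₀ hpl₁, hq₁ hk₁]
  have hsk : s ∉ pointsOn k := fun h => by
    rcases eq_or_eq_of_mem_pointsOn hsm hqm h hk₀ with rfl | rfl
    exacts [hs₀ hql₀, hq₁m hk₁]
  obtain ⟨g, hg, hg₁⟩ := exists_smul_frame (x := ![q₀, p, q₁]) (j := ![l₁, k, l₀]) (y := s)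
    (by
      intro a b
      change _ ∈ pointsOn _ ↔ _
      fin_cases a <;> fin_cases b <;> simp_all)
    (by
      intro b
      change _ ∉ pointsOn _
      fin_cases b <;> assumption)
  exact ⟨g, hg 0, hg 1, hg 2, hg₁⟩

theorem eq_diffVec {l : Line} {a : Fin 3} (h₁ : proj ones ∈ pointsOn l)
    (ha : proj (unitVec a) ∈ pointsOn l) : l = proj (diffVec a) := by
  obtain ⟨w, rfl⟩ := exists_proj_eq l
  rw [proj_mem_pointsOn_proj] at h₁ ha
  rw [proj_eq_proj_iff]
  revert w a
  decide +kernel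

theorem eq_sumVec {m : Line} {a : Fin 3} (h₁ : proj (unitVec a) ∈ pointsOn m)
    (h₂ : proj (diffVec a) ∈ pointsOn m) : m = proj (sumVec a) := by
  obtain ⟨w, rfl⟩ := exists_proj_eq m
  rw [proj_mem_pointsOn_proj] at h₁ h₂
  rw [proj_eq_proj_iff]
  revert w a
  decide +kernel

theorem eq_sumVec_of_mem_iff {m : Line} {a : Fin 3} (h₁ : proj ones ∉ pointsOn m)
    (h₂ : ∀ b, proj (unitVec b) ∈ pointsOn m ↔ b = a) : m = proj (sumVec a) := by
  obtain ⟨w, rfl⟩ := exists_proj_eq m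
  simp only [proj_mem_pointsOn_proj] at h₁ h₂
  rw [proj_eq_proj_iff]
  revert w a
  decide +kernel

theorem eq_diffVec_of_notMem {s : Point} {a : Fin 3} (h₁ : s ∈ pointsOn (proj (sumVec a)))
    (h₂ : ∀ b, s ∉ pointsOn (proj (diffVec b))) : s = proj (diffVec a) := by
  obtain ⟨w, rfl⟩ := exists_proj_eq s
  simp only [proj_mem_pointsOn_proj] at h₁ h₂
  rw [proj_eq_proj_iff]
  revert w a
  decide +kernel

theorem eq_signVec {n : Line} {a : Fin 3} (h₁ : proj ones ∉ pointsOn n)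
    (ha : proj (diffVec a) ∈ pointsOn n) (h₃ : proj (unitVec a) ∉ pointsOn n)
    (h₄ : proj (unitVec (a + 1)) ∉ pointsOn n) :
    n = proj (signVec a) := by
  obtain ⟨w, rfl⟩ := exists_proj_eq n
  simp only [proj_mem_pointsOn_proj] at h₁ ha h₃ h₄
  rw [proj_eq_proj_iff]
  revert w a
  decide +kernel

theorem eq_unitVec_two {q : Point} (hl₀ : q ∉ pointsOn (proj (diffVec 0)))
    (hl₁ : q ∉ pointsOn (proj (diffVec 1))) (hm : q ∉ pointsOn (proj (sumVec 0)))
    (hn : q ∉ pointsOn (proj (signVec 0))) (hq : q ∉ pointsOn (proj ones)) :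
    q = proj (unitVec 2) := by
  obtain ⟨v, rfl⟩ := exists_proj_eq q
  simp only [proj_mem_pointsOn_proj] at hl₀ hl₁ hm hn hq
  rw [proj_eq_proj_iff]
  revert v
  decide +kernel

/-- A map that preserves and reflects adjacency is an embedding if distinct vertices of its source
have distinct neighbourhoods. -/
def embeddingOfAdjIff {α β : Type*} {G : SimpleGraph α} {H : SimpleGraph β} (f : α → β)
    (hf : ∀ i j, H.Adj (f i) (f j) ↔ G.Adj i j) (hG : ∀ i j, (∀ k, G.Adj i k ↔ G.Adj j k) → i = j) :
    G ↪g H where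
  toFun := f
  inj' i j h := hG i j fun k => by rw [← hf, ← hf, h]
  map_rel_iff' := hf _ _

/-- The standard `Y₅₅₅` diagram, as an induced subgraph of the incidence graph. -/
def standardEmbedding : diagram ↪g incidenceGraph :=
  embeddingOfAdjIff standardNodes standardNodes_adj (by decide +kernel)

section PointCentered

variable {p : Point} {l : Fin 3 → Line} {q : Fin 3 → Point} {m : Fin 3 → Line} {s : Fin 3 → Point}
  {n : Fin 3 → Line}

namespace PointCentered

theorem exists_smul_frame (h : PointCentered p l q m s n) :
    ∃ g : GL (Fin 3) (ZMod 3), g • proj (unitVec 0) = q 0 ∧ g • proj (unitVec 1) = p ∧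
      g • proj (unitVec 2) = q 1 ∧ g • proj ones = s 0 :=
  exists_smul_frame_of_path (h.p_mem_l 0) (h.p_mem_l 1) (h.q_mem_l.2 rfl) (h.q_mem_l.2 rfl)
    (h.q_mem_m.2 rfl) (h.s_mem_m.2 rfl) (h.q_mem_l.not.2 (by decide))
    (h.q_mem_l.not.2 (by decide)) (h.q_mem_m.not.2 (by decide)) (h.s_notMem_l 0 0)
    (h.s_notMem_l 0 1)

theorem nodes_eq_standardNodes (h : PointCentered p l q m s n) (hp : p = proj ones)
    (hq₀ : q 0 = proj (unitVec 0)) (hq₁ : q 1 = proj (unitVec 1)) (hs₀ : s 0 = proj (diffVec 0)) :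
    nodes p l q m s n = standardNodes := by
  subst hp
  have line_eq {a : Fin 3} (ha : q a = proj (unitVec a)) : l a = proj (diffVec a) :=
    eq_diffVec (h.p_mem_l a) (ha ▸ h.q_mem_l.2 rfl)
  have hm₀ : m 0 = proj (sumVec 0) :=
    eq_sumVec (hq₀ ▸ h.q_mem_m.2 rfl) (hs₀ ▸ h.s_mem_m.2 rfl)
  have hn₀ : n 0 = proj (signVec 0) :=
    eq_signVec (h.p_notMem_n 0) (hs₀ ▸ h.s_mem_n.2 rfl) (hq₀ ▸ h.q_notMem_n 0 0)
      (hq₁ ▸ h.q_notMem_n 1 0)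
  have hq₂l₀ : q 2 ∉ pointsOn (proj (diffVec 0)) := line_eq hq₀ ▸ h.q_mem_l.not.2 (by decide)
  have hq₂ : q 2 = proj (unitVec 2) := by
    refine eq_unitVec_two hq₂l₀ (line_eq hq₁ ▸ h.q_mem_l.not.2 (by decide))
      (hm₀ ▸ h.q_mem_m.not.2 (by decide)) (hn₀ ▸ h.q_notMem_n 2 0) fun hq => ?_
    have h₁ : proj ones ∈ pointsOn (proj ones) := proj_mem_pointsOn_proj.2 (by decide)
    rcases eq_or_eq_of_mem_pointsOn (h.p_mem_l 2) (h.q_mem_l.2 rfl) h₁ hq with hpq | hl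
    · exact hq₂l₀ (hpq ▸ proj_mem_pointsOn_proj.2 (by decide))
    · exact h.s_notMem_l 0 2 (hs₀ ▸ hl ▸ proj_mem_pointsOn_proj.2 (by decide))
  obtain rfl : q = fun a => proj (unitVec a) := by
    funext a
    fin_cases a <;> assumption
  obtain rfl : l = fun a => proj (diffVec a) := funext fun a => line_eq rfl
  obtain rfl : m = fun a => proj (sumVec a) :=
    funext fun a => eq_sumVec_of_mem_iff (h.p_notMem_m a) fun b => h.q_mem_m
  obtain rfl : s = fun a => proj (diffVec a) :=
    funext fun a => eq_diffVec_of_notMem (h.s_mem_m.2 rfl) (h.s_notMem_l a)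
  obtain rfl : n = fun a => proj (signVec a) :=
    funext fun a => eq_signVec (h.p_notMem_n a) (h.s_mem_n.2 rfl) (h.q_notMem_n a a)
      (h.q_notMem_n (a + 1) a)
  exact standardNodes_eq.symm

end PointCentered

end PointCentered

theorem exists_iso_frame {f : diagram ↪g incidenceGraph} {p : Point} (hp : f none = .inl p) :
    ∃ e : incidenceGraph ≃g incidenceGraph, e (.inl (proj (unitVec 0))) = f (some (0, 1)) ∧
      e (.inl (proj (unitVec 1))) = f none ∧ e (.inl (proj (unitVec 2))) = f (some (1, 1)) ∧
      e (.inl (proj ones)) = f (some (0, 3)) := by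
  obtain ⟨l, q, m, s, n, hf⟩ := exists_eq_nodes f hp
  obtain ⟨g, h₀, h₁, h₂, h₃⟩ :=
    (pointCentered_of_adj_iff fun i j => hf ▸ f.map_adj_iff).exists_smul_frame
  rw [hf]
  exact ⟨collineation g, congrArg _ h₀, congrArg _ h₁, congrArg _ h₂, congrArg _ h₃⟩

theorem eq_standardNodes {f : diagram ↪g incidenceGraph} (h : f none = .inl (proj ones))
    (h₀ : f (some (0, 1)) = .inl (proj (unitVec 0)))
    (h₁ : f (some (1, 1)) = .inl (proj (unitVec 1)))
    (h₃ : f (some (0, 3)) = .inl (proj (diffVec 0))) : ⇑f = standardNodes := by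
  obtain ⟨l, q, m, s, n, hf⟩ := exists_eq_nodes f h
  rw [hf] at h₀ h₁ h₃ ⊢
  exact (pointCentered_of_adj_iff fun i j => hf ▸ f.map_adj_iff).nodes_eq_standardNodes rfl
    (Sum.inl_injective h₀) (Sum.inl_injective h₁) (Sum.inl_injective h₃)

theorem exists_iso_of_apply_none {f : diagram ↪g incidenceGraph} {p : Point}
    (hp : f none = .inl p) :
    ∃ e : incidenceGraph ≃g incidenceGraph, ∀ i, f i = e (standardNodes i) := by
  obtain ⟨e, he₀, he, he₁, he₃⟩ := exists_iso_frame hp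
  obtain ⟨e', he₀', he', he₁', he₃'⟩ := exists_iso_frame (f := standardEmbedding) rfl
  have h : ⇑(f.trans (e.symm.trans e').toRelEmbedding) = standardNodes := by
    apply eq_standardNodes <;> simp [← he₀, ← he, ← he₁, ← he₃, he₀', he', he₁', he₃'] <;> rfl
  refine ⟨e'.symm.trans e, fun i => ?_⟩
  simp [← h]

theorem exists_iso (f : diagram ↪g incidenceGraph) :
    ∃ e : incidenceGraph ≃g incidenceGraph, ∀ i, f i = e (standardNodes i) := by
  cases hf : f none with
  | inl p => exact exists_iso_of_apply_none hf
  | inr l =>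
    obtain ⟨e, he⟩ := exists_iso_of_apply_none (f := f.trans polarity.toRelEmbedding) (p := l)
      (congrArg polarity hf)
    exact ⟨e.trans polarity.symm, fun i => (polarity.symm_apply_eq.2 (he i).symm).symm⟩

/-! ### Induced `12`-gons -/

/-- A set of vertices is `12`-gon closed if it contains every vertex that completes an induced
`12`-gon whose other vertices are in the set. -/
def GonClosed {α : Type*} (G : SimpleGraph α) (T : Set α) : Prop :=
  ∀ g : SimpleGraph.cycleGraph 12 ↪g G, (∀ i ≠ 0, g i ∈ T) → g 0 ∈ T

theorem GonClosed.preimage {α β : Type*} {G : SimpleGraph α} {H : SimpleGraph β} {T : Set β}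
    (hT : GonClosed H T) (e : G ↪g H) : GonClosed G (e ⁻¹' T) :=
  fun g hg => hT (g.trans e) hg

theorem GonClosed.node_mem {T : Set (Point ⊕ Line)} (hT : GonClosed incidenceGraph T)
    (g : Fin 12 → NonzeroVec ⊕ NonzeroVec)
    (hg : ∀ i j, incidenceGraph.Adj (node (g i)) (node (g j)) ↔
      (SimpleGraph.cycleGraph 12).Adj i j)
    (h : ∀ i : Fin 11, node (g i.succ) ∈ T) : node (g 0) ∈ T :=
  hT (embeddingOfAdjIff (node ∘ g) hg (by decide +kernel))
    fun i hi => Fin.succ_pred i hi ▸ h _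

theorem GonClosed.node_mem_of_standardNodes_mem {T : Set (Point ⊕ Line)}
    (hT : GonClosed incidenceGraph T) (h : ∀ i, standardNodes i ∈ T) :
    node (.inr ones) ∈ T ∧ ∀ c, node (.inl (sumVec c)) ∈ T ∧ node (.inl (signVec c)) ∈ T ∧
      node (.inr (unitVec c)) ∈ T := by
  have h_p : node (.inl ones) ∈ T := h none
  have h_l (c) : node (.inr (diffVec c)) ∈ T := h (some (c, 0))
  have h_q (c) : node (.inl (unitVec c)) ∈ T := h (some (c, 1))
  have h_m (c) : node (.inr (sumVec c)) ∈ T := h (some (c, 2))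
  have h_s (c) : node (.inl (diffVec c)) ∈ T := h (some (c, 3))
  have h_n (c) : node (.inr (signVec c)) ∈ T := h (some (c, 4))
  have h_sum (c) : node (.inl (sumVec c)) ∈ T :=
    hT.node_mem ![.inl (sumVec c), .inr (signVec (c + 1)), .inl (diffVec (c + 1)),
      .inr (sumVec (c + 1)), .inl (unitVec (c + 1)), .inr (diffVec (c + 1)), .inl ones,
      .inr (diffVec (c + 2)), .inl (unitVec (c + 2)), .inr (sumVec (c + 2)),
      .inl (diffVec (c + 2)), .inr (signVec (c + 2))] (by revert c; decide +kernel)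
      (by simp [Fin.forall_fin_succ, *])
  have h_sign (c) : node (.inl (signVec c)) ∈ T :=
    hT.node_mem ![.inl (signVec c), .inr (sumVec (c + 1)), .inl (diffVec (c + 1)),
      .inr (signVec (c + 1)), .inl (sumVec c), .inr (signVec (c + 2)), .inl (sumVec (c + 1)),
      .inr (diffVec (c + 1)), .inl ones, .inr (diffVec (c + 2)), .inl (unitVec (c + 2)),
      .inr (sumVec (c + 2))] (by revert c; decide +kernel) (by simp [Fin.forall_fin_succ, *])
  have h_unit (c) : node (.inr (unitVec c)) ∈ T :=
    hT.node_mem ![.inr (unitVec c), .inl (diffVec c), .inr (sumVec c), .inl (unitVec c),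
      .inr (diffVec c), .inl ones, .inr (diffVec (c + 1)), .inl (sumVec (c + 1)),
      .inr (signVec (c + 2)), .inl (diffVec (c + 2)), .inr (sumVec (c + 2)),
      .inl (unitVec (c + 2))] (by revert c; decide +kernel) (by simp [Fin.forall_fin_succ, *])
  refine ⟨?_, fun c => ⟨h_sum c, h_sign c, h_unit c⟩⟩
  exact hT.node_mem ![.inr ones, .inl ones, .inr (diffVec 0), .inl (unitVec 0), .inr (unitVec 1),
    .inl (unitVec 2), .inr (unitVec 0), .inl (unitVec 1), .inr (sumVec 1), .inl (signVec 2),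
    .inr (signVec 2), .inl (diffVec 2)] (by decide +kernel) (by simp [Fin.forall_fin_succ, *])

theorem exists_proj_eq_of_standard (p : Point) :
    p = proj ones ∨ ∃ c, p = proj (unitVec c) ∨ p = proj (diffVec c) ∨ p = proj (sumVec c) ∨
      p = proj (signVec c) := by
  obtain ⟨v, rfl⟩ := exists_proj_eq p
  simp only [proj_eq_proj_iff]
  revert v
  decide +kernel

theorem GonClosed.eq_univ {T : Set (Point ⊕ Line)} (hT : GonClosed incidenceGraph T)
    (f : diagram ↪g incidenceGraph) (h : ∀ i, f i ∈ T) : T = Set.univ := by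
  obtain ⟨e, he⟩ := exists_iso f
  have h' (i) : standardNodes i ∈ e ⁻¹' T := by simpa only [Set.mem_preimage, ← he] using h i
  obtain ⟨h_ones, h_rest⟩ := (hT.preimage e.toRelEmbedding).node_mem_of_standardNodes_mem h'
  suffices ∀ v, v ∈ e ⁻¹' T from Set.eq_univ_of_forall fun v => by simpa using this (e.symm v)
  rintro (p | l)
  · rcases exists_proj_eq_of_standard p with rfl | ⟨c, rfl | rfl | rfl | rfl⟩
    exacts [h' none, h' (some (c, 1)), h' (some (c, 3)), (h_rest c).1, (h_rest c).2.1]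
  · rcases exists_proj_eq_of_standard l with rfl | ⟨c, rfl | rfl | rfl | rfl⟩
    exacts [h_ones, (h_rest c).2.2, h' (some (c, 0)), h' (some (c, 2)), h' (some (c, 4))]

/-! ### Isometries and reflections -/

theorem conj_ω : conj ω = -1 - ω := by
  have h := θ_eq
  rw [θ] at h
  linear_combination -h

theorem conj_θ : conj θ = -θ := by
  rw [θ_eq, map_add, map_mul, conj_ω, map_one, map_ofNat]
  ring

theorem θ_mul_θ : θ * θ = -3 := by
  rw [θ_eq]
  linear_combination 4 * ω_sq

theorem θ_ne_zero : θ ≠ 0 := by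
  intro h
  have := θ_mul_θ
  norm_num [h] at this

theorem ω_pow_three : ω ^ 3 = 1 := by
  linear_combination (ω - 1) * ω_sq

theorem neg_ω_pow_six : (-ω) ^ 6 = 1 := by
  linear_combination (ω ^ 3 + 1) * ω_pow_three

theorem neg_ω_pow_eleven : (-ω) ^ 11 = -ω ^ 2 := by
  linear_combination (-ω) ^ 5 * neg_ω_pow_six - ω ^ 2 * ω_pow_three

theorem ω_sub_one_mul_θ : (ω - 1) * θ = 3 * ω ^ 2 := by
  rw [θ_eq]
  linear_combination -ω_sq

theorem ωUnit_val : (ωUnit : ℂ) = ω := rfl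

section herm

variable (x y z : V) (a : ℂ)

theorem herm_symm : herm y x = conj (herm x y) := by
  simp only [herm, map_add, map_neg, map_mul, map_sum, Complex.conj_conj, mul_comm]

theorem herm_smul_right : herm x (a • y) = conj a * herm x y := by
  rw [herm_symm, herm_smul_left, map_mul, ← herm_symm]

theorem herm_add_right : herm x (y + z) = herm x y + herm x z := by
  rw [herm_symm, herm_add_left, map_add, ← herm_symm, ← herm_symm]

theorem herm_sub_left : herm (x - y) z = herm x z - herm y z := by
  rw [sub_eq_add_neg, ← neg_one_smul ℂ y, herm_add_left, herm_smul_left]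
  ring

theorem herm_sub_right : herm x (y - z) = herm x y - herm x z := by
  rw [herm_symm, herm_sub_left, map_sub, ← herm_symm, ← herm_symm]

theorem herm_zero_left : herm 0 x = 0 := by simp [herm]

theorem herm_sum_left {ι : Type*} (s : Finset ι) (f : ι → V) :
    herm (∑ i ∈ s, f i) y = ∑ i ∈ s, herm (f i) y := by
  induction s using Finset.cons_induction with
  | empty => simp [herm_zero_left]
  | cons i s hi ih => rw [Finset.sum_cons, Finset.sum_cons, herm_add_left, ih]

theorem herm_sum_right {ι : Type*} (s : Finset ι) (f : ι → V) :
    herm y (∑ i ∈ s, f i) = ∑ i ∈ s, herm y (f i) := by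
  rw [herm_symm, herm_sum_left, map_sum]
  simp only [← herm_symm]

end herm

theorem herm_self_re_pos {x : V} (hx : x.1 = 0) (hx' : x ≠ 0) : 0 < (herm x x).re := by
  have h : herm x x = ((∑ p, Complex.normSq (x.2 p) : ℝ) : ℂ) := by
    simp [herm, hx, Complex.mul_conj]
  rw [h, Complex.ofReal_re]
  refine (Finset.sum_nonneg fun p _ => Complex.normSq_nonneg _).lt_of_ne' fun h => hx' ?_
  rw [Finset.sum_eq_zero_iff_of_nonneg fun p _ => Complex.normSq_nonneg _] at h
  exact Prod.ext hx (funext fun p => Complex.normSq_eq_zero.1 (h p (Finset.mem_univ p)))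

theorem eq_zero_of_herm_eq_zero {v w : V} (hv : (herm v v).re < 0) (hw : (herm w w).re ≤ 0)
    (h : herm w v = 0) : w = 0 := by
  have h' : herm v w = 0 := by rw [herm_symm, h, map_zero]
  have hu : herm (v.1 • w - w.1 • v) (v.1 • w - w.1 • v) =
      (Complex.normSq v.1 : ℝ) * herm w w + (Complex.normSq w.1 : ℝ) * herm v v := by
    simp only [herm_sub_left, herm_sub_right, herm_smul_left, herm_smul_right, h, h',
      ← Complex.mul_conj]
    ring
  have hu' : v.1 • w = w.1 • v := by
    by_contra hne
    have hpos := herm_self_re_pos (x := v.1 • w - w.1 • v) (by simp [mul_comm]) (sub_ne_zero.2 hne)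
    rw [hu, Complex.add_re, Complex.re_ofReal_mul, Complex.re_ofReal_mul] at hpos
    nlinarith [Complex.normSq_nonneg v.1, Complex.normSq_nonneg w.1]
  by_contra hne
  have hwv : w.1 * herm v v = 0 := by rw [← herm_smul_left, ← hu', herm_smul_left, h, mul_zero]
  have hw₁ : w.1 = 0 := (mul_eq_zero.1 hwv).resolve_right fun h0 => by simp [h0] at hv
  exact (herm_self_re_pos hw₁ hne).not_ge hw

section reflection

theorem reflection_apply (ζ : ℂˣ) (r x : V) :
    reflection ζ r x = x + (((ζ : ℂ) - 1) * (herm x r / herm r r)) • r := rfl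

theorem reflection_inv (ζ : ℂˣ) (r : V) : (reflection ζ r)⁻¹ = reflection ζ⁻¹ r := rfl

theorem reflection_smul (ζ : ℂˣ) {c : ℂ} (hc : c ≠ 0) (r : V) :
    reflection ζ (c • r) = reflection ζ r := by
  ext1 x
  have hc' : conj c ≠ 0 := (map_ne_zero _).2 hc
  rw [reflection_apply, reflection_apply, smul_smul, herm_smul_right, herm_smul_right,
    herm_smul_left]
  congr 2
  by_cases hr : herm r r = 0
  · simp [hr]
  · field_simp

theorem mul_reflection_mul_inv {g : V ≃ₗ[ℂ] V} (hg : ∀ x y, herm (g x) (g y) = herm x y) (ζ : ℂˣ)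
    (r : V) : g * reflection ζ r * g⁻¹ = reflection ζ (g r) := by
  ext1 x
  obtain ⟨y, rfl⟩ := g.surjective x
  have : g⁻¹ (g y) = y := g.symm_apply_apply y
  simp only [LinearEquiv.mul_apply, this, reflection_apply, map_add, map_smul, hg]

variable {r x : V}

theorem herm_reflection (hr : herm r r = 3) (x y : V) :
    herm (reflection ωUnit r x) (reflection ωUnit r y) = herm x y := by
  simp only [reflection_apply, herm_add_left, herm_add_right, herm_smul_left, herm_smul_right, hr,
    map_mul, map_sub, map_one, map_div₀, map_ofNat, ← herm_symm, ωUnit_val, conj_ω]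
  linear_combination (herm x r * herm r y / 3) * (-1 : ℂ) * ω_sq

theorem reflection_self (hr : herm r r = 3) : reflection ωUnit r r = ω • r := by
  rw [reflection_apply, hr, ωUnit_val]
  module

theorem reflection_of_herm_eq_zero (ζ : ℂˣ) (h : herm x r = 0) : reflection ζ r x = x := by
  rw [reflection_apply, h, zero_div, mul_zero, zero_smul, add_zero]

theorem reflection_of_herm_eq_θ (hr : herm r r = 3) (h : herm x r = θ) :
    reflection ωUnit r x = x + ω ^ 2 • r := by
  rw [reflection_apply, hr, h, ωUnit_val, mul_div_assoc', ω_sub_one_mul_θ, mul_div_cancel_left₀]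
  norm_num

theorem reflection_of_herm_eq_neg_θ (hr : herm r r = 3) (h : herm x r = -θ) :
    reflection ωUnit r x = x - ω ^ 2 • r := by
  rw [reflection_apply, hr, h, ωUnit_val, mul_div_assoc', mul_neg, ω_sub_one_mul_θ, neg_div,
    mul_div_cancel_left₀ _ (by norm_num), neg_smul, sub_eq_add_neg]

end reflection

/-- The group of the isometries of `V` that act trivially on `V ⧸ W`. -/
def isometriesMod (W : Submodule ℂ V) : Subgroup (V ≃ₗ[ℂ] V) where
  carrier := {g | (∀ x y, herm (g x) (g y) = herm x y) ∧ ∀ x, g x - x ∈ W}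
  one_mem' := ⟨fun _ _ => rfl, fun x => by simp⟩
  mul_mem' := by
    rintro g h ⟨hg, hg'⟩ ⟨hh, hh'⟩
    refine ⟨fun x y => (hg _ _).trans (hh x y), fun x => ?_⟩
    simpa using W.add_mem (hg' (h x)) (hh' x)
  inv_mem' := by
    rintro g ⟨hg, hg'⟩
    have apply_inv (x : V) : g (g⁻¹ x) = x := g.apply_symm_apply x
    refine ⟨fun x y => by rw [← hg, apply_inv, apply_inv], fun x => ?_⟩
    simpa [apply_inv] using W.neg_mem (hg' (g⁻¹ x))

theorem reflection_mem_isometriesMod {W : Submodule ℂ V} {r : V} (hr : herm r r = 3) (hW : r ∈ W) :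
    reflection ωUnit r ∈ isometriesMod W :=
  ⟨herm_reflection hr, fun x => by simpa [reflection_apply] using W.smul_mem _ hW⟩

theorem eq_one_of_mem_isometriesMod {W : Submodule ℂ V} {g : V ≃ₗ[ℂ] V} (hg : g ∈ isometriesMod W)
    {v : V} (hvW : v ∈ W) (hv : (herm v v).re < 0) (h : ∀ w ∈ W, g w = w) : g = 1 := by
  have orthogonal (x : V) {w : V} (hw : w ∈ W) : herm (g x - x) w = 0 := by
    rw [herm_sub_left, sub_eq_zero, ← hg.1 x w, h w hw]
  ext1 x
  exact sub_eq_zero.1 <| eq_zero_of_herm_eq_zero hv (by simp [orthogonal x (hg.2 x)])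
    (orthogonal x hvW)

/-! ### Coxeter and Garside elements of chains -/

/-- The vectors `r 0, …, r n` form a chain: they are of norm `3`, consecutive ones have inner
product `θ`, and the others are orthogonal. -/
structure IsChain (r : ℕ → V) (n : ℕ) : Prop where
  herm_self {i : ℕ} (hi : i ≤ n) : herm (r i) (r i) = 3
  herm_succ {i : ℕ} (hi : i < n) : herm (r i) (r (i + 1)) = θ
  herm_eq_zero {i j : ℕ} (hij : i + 1 < j) (hj : j ≤ n) : herm (r i) (r j) = 0

/-- The product of the `ω`-reflections in the first `m` vectors of a sequence, which is a Coxeter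
element when they form a chain. -/
def coxeter (r : ℕ → V) : ℕ → V ≃ₗ[ℂ] V
  | 0 => 1
  | m + 1 => coxeter r m * reflection ωUnit (r m)

/-- The image of the Garside element of the braid group on `m + 1` strands whose standard generators
act by the `ω`-reflections in the first `m` vectors of a sequence. -/
def garside (r : ℕ → V) : ℕ → V ≃ₗ[ℂ] V
  | 0 => 1
  | m + 1 => coxeter r (m + 1) * garside r m

theorem coxeter_succ_apply (r : ℕ → V) (m : ℕ) (x : V) :
    coxeter r (m + 1) x = coxeter r m (reflection ωUnit (r m) x) := rfl

theorem coxeter_mem {H : Subgroup (V ≃ₗ[ℂ] V)} {r : ℕ → V} {m : ℕ}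
    (h : ∀ i < m, reflection ωUnit (r i) ∈ H) : coxeter r m ∈ H := by
  induction m with
  | zero => exact H.one_mem
  | succ m ih => exact H.mul_mem (ih fun i hi => h i (by lia)) (h m (by lia))

theorem garside_mem {H : Subgroup (V ≃ₗ[ℂ] V)} {r : ℕ → V} {m : ℕ}
    (h : ∀ i < m, reflection ωUnit (r i) ∈ H) : garside r m ∈ H := by
  induction m with
  | zero => exact H.one_mem
  | succ m ih => exact H.mul_mem (coxeter_mem h) (ih fun i hi => h i (by lia))

namespace IsChain

variable {r : ℕ → V} {n m i j : ℕ} (h : IsChain r n)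
include h

theorem herm_succ_left (hi : i < n) : herm (r (i + 1)) (r i) = -θ := by
  rw [herm_symm, h.herm_succ hi, conj_θ]

theorem herm_eq_zero_symm (hij : i + 1 < j) (hj : j ≤ n) : herm (r j) (r i) = 0 := by
  rw [herm_symm, h.herm_eq_zero hij hj, map_zero]

theorem reflection_apply_reflection_apply (hi : i < n) :
    reflection ωUnit (r i) (reflection ωUnit (r (i + 1)) (r i)) = ω ^ 2 • r (i + 1) := by
  rw [reflection_of_herm_eq_θ (h.herm_self hi) (h.herm_succ hi), map_add, map_smul,
    reflection_self (h.herm_self hi.le),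
    reflection_of_herm_eq_neg_θ (h.herm_self hi.le) (h.herm_succ_left hi), smul_sub, smul_smul,
    ← pow_add, show ω ^ (2 + 2) = ω by rw [pow_succ, ω_pow_three, one_mul]]
  abel

theorem herm_coxeter (hm : m ≤ n + 1) (x y : V) :
    herm (coxeter r m x) (coxeter r m y) = herm x y :=
  (coxeter_mem fun _ hi => reflection_mem_isometriesMod (W := ⊤) (h.herm_self (by lia))
    trivial).1 x y

theorem coxeter_apply_of_lt (hmj : m < j) (hj : j ≤ n) : coxeter r m (r j) = r j := by
  induction m with
  | zero => rfl
  | succ m ih =>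
    rw [coxeter_succ_apply, reflection_of_herm_eq_zero _ (h.herm_eq_zero_symm hmj hj), ih (by lia)]

theorem garside_apply_of_lt (hmj : m < j) (hj : j ≤ n) : garside r m (r j) = r j := by
  induction m with
  | zero => rfl
  | succ m ih =>
    rw [garside, LinearEquiv.mul_apply, ih (by lia), h.coxeter_apply_of_lt hmj hj]

theorem coxeter_apply_of_add_two_le (hjm : j + 2 ≤ m) (hm : m ≤ n + 1) :
    coxeter r m (r j) = ω ^ 2 • r (j + 1) := by
  induction m, hjm using Nat.le_induction with
  | base =>
    rw [coxeter_succ_apply, coxeter_succ_apply, h.reflection_apply_reflection_apply (by lia),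
      map_smul, h.coxeter_apply_of_lt (by lia) (by lia)]
  | succ m hjm ih =>
    rw [coxeter_succ_apply, reflection_of_herm_eq_zero _ (h.herm_eq_zero (by lia) (by lia)),
      ih (by lia)]

theorem smul_coxeter_apply_self (hm : m ≤ n) :
    (-ω) ^ m • coxeter r m (r m) = ∑ j ∈ Finset.range (m + 1), (-ω) ^ j • r j := by
  induction m with
  | zero => simp [coxeter]
  | succ m ih =>
    rw [coxeter_succ_apply,
      reflection_of_herm_eq_neg_θ (h.herm_self (by lia)) (h.herm_succ_left (by lia)), map_sub,
      h.coxeter_apply_of_lt (by lia) hm, map_smul, Finset.sum_range_succ _ (m + 1), ← ih (by lia),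
      smul_sub, smul_smul, show (-ω) ^ (m + 1) * ω ^ 2 = -(-ω) ^ m by
        rw [pow_succ]; linear_combination (-(-ω) ^ m) * ω_pow_three]
    module

theorem coxeter_succ_apply_coxeter_apply (hm : m ≤ n) :
    coxeter r (m + 1) (coxeter r m (r m)) = ((-1) ^ m * ω ^ (2 * m + 1)) • r 0 := by
  have key : (-ω) ^ m • coxeter r (m + 1) (coxeter r m (r m)) = ω • r 0 := by
    have shift : ∑ j ∈ Finset.range m, (-ω) ^ j • coxeter r (m + 1) (r j) =
        (-ω) • ∑ j ∈ Finset.range m, (-ω) ^ (j + 1) • r (j + 1) := by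
      rw [Finset.smul_sum]
      refine Finset.sum_congr rfl fun j hj => ?_
      rw [h.coxeter_apply_of_add_two_le (by simpa using hj) (by lia), smul_smul, smul_smul]
      congr 1
      ring
    rw [← map_smul, h.smul_coxeter_apply_self hm, map_sum]
    simp only [map_smul]
    rw [Finset.sum_range_succ, shift, coxeter_succ_apply r m (r m),
      reflection_self (h.herm_self hm), map_smul, smul_comm, h.smul_coxeter_apply_self hm,
      Finset.sum_range_succ', pow_zero, one_smul]
    module
  have hω : (-1) ^ m * ω ^ (2 * m) * (-ω) ^ m = 1 := by
    rw [pow_mul, ← mul_pow, ← mul_pow, show -1 * ω ^ 2 * -ω = 1 by linear_combination ω_pow_three,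
      one_pow]
  rw [pow_succ, ← mul_assoc, mul_smul, ← key, smul_smul, hω, one_smul]

theorem garside_apply_self (hm : m ≤ n) : garside r m (r m) = coxeter r m (r m) := by
  cases m with
  | zero => rfl
  | succ m => rw [garside, LinearEquiv.mul_apply, h.garside_apply_of_lt m.lt_succ_self hm]

theorem garside_apply (hi : i ≤ m) (hm : m ≤ n) :
    garside r (m + 1) (r i) = ((-1) ^ i * ω ^ (2 * m + 1)) • r (m - i) := by
  induction m, hi using Nat.le_induction with
  | base =>
    rw [garside, LinearEquiv.mul_apply, h.garside_apply_self hm,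
      h.coxeter_succ_apply_coxeter_apply hm, Nat.sub_self]
  | succ m hi ih =>
    rw [garside, LinearEquiv.mul_apply, ih (by lia), map_smul,
      h.coxeter_apply_of_add_two_le (by lia) (by lia), smul_smul, show m + 1 - i = m - i + 1 by lia]
    congr 1
    ring

theorem reflection_sum_mem {H : Subgroup (V ≃ₗ[ℂ] V)} (hH : ∀ i ≤ n, reflection ωUnit (r i) ∈ H) :
    reflection ωUnit (∑ j ∈ Finset.range (n + 1), (-ω) ^ j • r j) ∈ H := by
  have hc : coxeter r n ∈ H := coxeter_mem fun i hi => hH i hi.le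
  rw [← h.smul_coxeter_apply_self le_rfl,
    reflection_smul _ (pow_ne_zero _ (neg_ne_zero.2 ω_ne_zero)),
    ← mul_reflection_mul_inv (h.herm_coxeter n.le_succ)]
  exact H.mul_mem (H.mul_mem hc (hH n le_rfl)) (H.inv_mem hc)

end IsChain

/-! ### The roots of a `12`-gon -/

theorem card_pointsOn (l : Line) : (pointsOn l).ncard = 4 := by
  have hpoint : Nat.card Point = 13 := by
    rw [Projectivization.card_of_finrank (ZMod 3) (Fin 3 → ZMod 3) (Module.finrank_fin_fun _)]
    simp [Finset.sum_range_succ]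
  have horder := Configuration.ProjectivePlane.card_points Point Line
  rw [← Nat.card_eq_fintype_card, hpoint] at horder
  have : Configuration.ProjectivePlane.order Point Line = 3 := by nlinarith
  have hl := Configuration.ProjectivePlane.pointCount_eq Point l
  rwa [this] at hl

theorem card_pointsOn_inter {l m : Line} (h : l ≠ m) : (pointsOn l ∩ pointsOn m).ncard = 1 := by
  rw [Set.ncard_eq_one]
  obtain ⟨p, hl, hm⟩ := exists_mem_pointsOn h
  rw [mem_pointsOn_comm] at hl hm
  exact ⟨p, Set.eq_singleton_iff_unique_mem.2 ⟨⟨hl, hm⟩, fun q hq =>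
    (eq_or_eq_of_mem_pointsOn hq.1 hl hq.2 hm).resolve_right h⟩⟩

theorem sum_indicator_pointsOn_mul {A : Type*} [CommSemiring A] (l m : Line) [Decidable (l = m)] :
    ∑ p, (pointsOn l).indicator (1 : Point → A) p * (pointsOn m).indicator 1 p =
      if l = m then 4 else 1 := by
  classical
  have hcard : ∑ p, (pointsOn l).indicator (1 : Point → A) p * (pointsOn m).indicator 1 p =
      (pointsOn l ∩ pointsOn m).ncard := by
    simp only [Set.indicator_apply, Pi.one_apply, ite_zero_mul_ite_zero, mul_one, Finset.sum_boole,
      Set.ncard_eq_toFinset_card', ← Set.mem_inter_iff, Set.filter_mem_univ_eq_toFinset]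
  rw [hcard]
  split_ifs with h
  · rw [h, Set.inter_self, card_pointsOn, Nat.cast_ofNat]
  · rw [card_pointsOn_inter h, Nat.cast_one]

theorem lineRoot_snd_apply (l : Line) (p : Point) [Decidable (p ∈ pointsOn l)] :
    (lineRoot l).2 p = if p ∈ pointsOn l then 1 else 0 := by
  classical
  simp only [lineRoot, Set.indicator_apply, Pi.one_apply]

theorem pointRoot_snd_apply (p q : Point) [Decidable (q = p)] :
    (pointRoot p).2 q = if q = p then θ else 0 := by
  classical
  simp only [pointRoot, Pi.single_apply]
  congr

theorem herm_pointRoot_right (x : V) (p : Point) : herm x (pointRoot p) = -θ * x.2 p := by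
  classical
  simp [herm, pointRoot, Pi.single_apply, apply_ite conj, conj_θ, mul_comm]

theorem herm_lineRoot_lineRoot (l m : Line) [Decidable (l = m)] :
    herm (lineRoot l) (lineRoot m) = if l = m then 3 else 0 := by
  have hconj (p : Point) :
      conj ((pointsOn m).indicator (1 : Point → ℂ) p) = (pointsOn m).indicator 1 p := by
    classical
    simp [Set.indicator_apply, apply_ite conj]
  simp only [herm, lineRoot, hconj, sum_indicator_pointsOn_mul, map_one]
  split_ifs <;> norm_num

theorem herm_pointRoot_pointRoot (p q : Point) [Decidable (p = q)] :
    herm (pointRoot p) (pointRoot q) = if p = q then 3 else 0 := by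
  classical
  rw [herm_pointRoot_right, pointRoot_snd_apply]
  simp only [eq_comm (a := q)]
  split_ifs
  · linear_combination -θ_mul_θ
  · ring

theorem herm_lineRoot_pointRoot (l : Line) (p : Point) [Decidable (p ∈ pointsOn l)] :
    herm (lineRoot l) (pointRoot p) = if p ∈ pointsOn l then -θ else 0 := by
  rw [herm_pointRoot_right, lineRoot_snd_apply]
  split_ifs <;> ring

theorem herm_pointRoot_lineRoot (p : Point) (l : Line) [Decidable (p ∈ pointsOn l)] :
    herm (pointRoot p) (lineRoot l) = if p ∈ pointsOn l then θ else 0 := by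
  rw [herm_symm, herm_lineRoot_pointRoot]
  split_ifs <;> simp [conj_θ]

theorem herm_root_root (u v : Point ⊕ Line) [Decidable (u = v)]
    [Decidable (incidenceGraph.Adj u v)] :
    herm (root u) (root v) =
      if u = v then 3 else if incidenceGraph.Adj u v then (if u.isLeft then θ else -θ) else 0 := by
  classical
  rcases u with p | l <;> rcases v with q | m <;>
    simp [root, herm_pointRoot_pointRoot, herm_lineRoot_pointRoot, herm_pointRoot_lineRoot,
      herm_lineRoot_lineRoot]

theorem herm_root_self (u : Point ⊕ Line) : herm (root u) (root u) = 3 := by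
  classical
  rw [herm_root_root, if_pos rfl]

/-- The vectors `g 0, …, g 11` form a `12`-gon: they are of norm `3`, cyclically consecutive ones
have inner product `θ`, and the others are orthogonal. -/
structure IsGon (g : Fin 12 → V) : Prop where
  herm_self (i : Fin 12) : herm (g i) (g i) = 3
  herm_succ (i : Fin 12) : herm (g i) (g (i + 1)) = θ
  herm_eq_zero {i j : Fin 12} (hij : i ≠ j) (h : j ≠ i + 1) (h' : i ≠ j + 1) : herm (g i) (g j) = 0

namespace IsGon

variable {g : Fin 12 → V}

theorem herm_succ_left (hg : IsGon g) (i : Fin 12) : herm (g (i + 1)) (g i) = -θ := by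
  rw [herm_symm, hg.herm_succ, conj_θ]

theorem rotate (hg : IsGon g) (k : Fin 12) : IsGon fun i => g (i + k) where
  herm_self i := hg.herm_self _
  herm_succ i := by rw [add_right_comm, hg.herm_succ]
  herm_eq_zero hij h h' := hg.herm_eq_zero (by simpa) (by rwa [add_right_comm, Ne, add_left_inj])
    (by rwa [add_right_comm, Ne, add_left_inj])

theorem reverse (hg : IsGon g) (k : Fin 12) : IsGon fun i => (-1 : ℂ) ^ i.val • g (k - i) where
  herm_self i := by
    rw [herm_smul_left, herm_smul_right, hg.herm_self, map_pow, map_neg, map_one, ← mul_assoc,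
      ← mul_pow, neg_one_mul, neg_neg, one_pow, one_mul]
  herm_succ i := by
    have h := hg.herm_succ_left (k - (i + 1))
    rw [← sub_sub, sub_add_cancel] at h
    have hsign : (-1 : ℂ) ^ i.val * (-1) ^ (i + 1).val = -1 := by
      have : ∀ i : Fin 12, (-1 : ℤ) ^ i.val * (-1) ^ (i + 1).val = -1 := by decide
      exact_mod_cast this i
    rw [herm_smul_left, herm_smul_right, ← sub_sub, h, map_pow, map_neg, map_one]
    linear_combination -θ * hsign
  herm_eq_zero {i j} hij h h' := by
    rw [herm_smul_left, herm_smul_right, hg.herm_eq_zero, mul_zero, mul_zero]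
    · simpa using hij
    · rintro e
      exact h' (by rw [← sub_eq_zero] at e ⊢; rw [← e]; abel)
    · rintro e
      exact h (by rw [← sub_eq_zero] at e ⊢; rw [← e]; abel)

theorem isChain (hg : IsGon g) : IsChain (fun i => g (Fin.ofNat 12 i)) 10 where
  herm_self _ := hg.herm_self _
  herm_succ {i} hi := by
    rw [← hg.herm_succ]
    congr 2
    interval_cases i <;> rfl
  herm_eq_zero {i j} hij hj := by
    have hi : i < 10 := by omega
    interval_cases j <;> interval_cases i <;>
      first | omega | exact hg.herm_eq_zero (by decide) (by decide) (by decide)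

theorem herm_sum (hg : IsGon g) (c : Fin 12 → ℂ) (k : Fin 12) :
    herm (∑ i, c i • g i) (g k) = 3 * c k + θ * c (k - 1) - θ * c (k + 1) := by
  obtain ⟨h₁, h₂, h₃⟩ : k ≠ k - 1 ∧ k ≠ k + 1 ∧ k - 1 ≠ k + 1 := by revert k; decide
  have hk := hg.herm_succ (k - 1)
  rw [sub_add_cancel] at hk
  have hrest (i) (_ : i ∈ Finset.univ) (hi : i ∉ ({k, k - 1, k + 1} : Finset (Fin 12))) :
      herm (c i • g i) (g k) = 0 := by
    simp only [Finset.mem_insert, Finset.mem_singleton, not_or] at hi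
    rw [herm_smul_left, hg.herm_eq_zero hi.1 (fun e => hi.2.1 (eq_sub_of_add_eq e.symm)) hi.2.2,
      mul_zero]
  rw [herm_sum_left, ← Finset.sum_subset (Finset.subset_univ {k, k - 1, k + 1}) hrest,
    Finset.sum_insert (by simp [h₁, h₂]), Finset.sum_insert (by simp [h₃]), Finset.sum_singleton,
    herm_smul_left, herm_smul_left, herm_smul_left, hg.herm_self, hk, hg.herm_succ_left]
  ring

theorem herm_sum_pow (hg : IsGon g) {z : ℂ} (hz : z ^ 12 = 1) (k : Fin 12) :
    herm (∑ i, z ^ i.val • g i) (g k) = (3 + θ * (z ^ 11 - z)) * z ^ k.val := by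
  have hpow (j : Fin 12) : z ^ (k + j).val = z ^ k.val * z ^ j.val := by
    rw [Fin.val_add, ← pow_eq_pow_mod _ hz, pow_add]
  rw [hg.herm_sum, show k - 1 = k + 11 from sub_eq_add_neg k 1, hpow, hpow,
    show (11 : Fin 12).val = 11 from rfl, show (1 : Fin 12).val = 1 from rfl]
  ring

theorem herm_sum_pow_self (hg : IsGon g) {z : ℂ} (hz : z ^ 12 = 1) :
    herm (∑ i, z ^ i.val • g i) (∑ i, z ^ i.val • g i) = 12 * (3 + θ * (z ^ 11 - z)) := by
  have hnorm : z * conj z = 1 := by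
    rw [Complex.mul_conj, Complex.normSq_eq_norm_sq, Complex.norm_eq_one_of_pow_eq_one hz (by simp)]
    norm_num
  have hterm (k : Fin 12) : conj (z ^ k.val) * ((3 + θ * (z ^ 11 - z)) * z ^ k.val) =
      3 + θ * (z ^ 11 - z) := by
    rw [mul_left_comm, map_pow, ← mul_pow, mul_comm (conj z), hnorm, one_pow, mul_one]
  simp only [herm_sum_right, herm_smul_right, hg.herm_sum_pow hz, hterm, Finset.sum_const,
    Finset.card_univ, Fintype.card_fin, nsmul_eq_mul, Nat.cast_ofNat]

theorem exists_mem_span_herm_self_neg (hg : IsGon g) :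
    ∃ v ∈ Submodule.span ℂ (Set.range g), (herm v v).re < 0 := by
  refine ⟨∑ i, (-Complex.I) ^ i.val • g i, Submodule.sum_mem _ fun i _ =>
    Submodule.smul_mem _ _ (Submodule.subset_span ⟨i, rfl⟩), ?_⟩
  have hI : (-Complex.I) ^ 4 = 1 := by rw [Even.neg_pow (by decide), Complex.I_pow_four]
  have hθ : θ = Real.sqrt 3 * Complex.I := by rw [θ_eq, ω]; ring
  have hnorm : 12 * (3 + θ * ((-Complex.I) ^ 11 - -Complex.I)) =
      ((12 * (3 - 2 * Real.sqrt 3) : ℝ) : ℂ) := by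
    have hI' : (-Complex.I) ^ 11 = Complex.I := by
      linear_combination ((-Complex.I) ^ 7 + (-Complex.I) ^ 3) * hI - Complex.I * Complex.I_sq
    rw [hI', hθ]
    push_cast
    linear_combination 24 * Real.sqrt 3 * Complex.I_sq
  rw [hg.herm_sum_pow_self (by rw [pow_mul _ 4 3, hI, one_pow]), hnorm, Complex.ofReal_re]
  nlinarith [Real.sq_sqrt (show (0 : ℝ) ≤ 3 by norm_num), Real.sqrt_nonneg 3]

theorem sum_eq_zero (hg : IsGon g) : ∑ i, (-ω) ^ i.val • g i = 0 := by
  have hω : (-ω) ^ 12 = 1 := by rw [pow_mul _ 6 2, neg_ω_pow_six, one_pow]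
  have hθ : 3 + θ * ((-ω) ^ 11 - -ω) = 0 := by
    rw [neg_ω_pow_eleven, θ_eq]
    linear_combination -2 * ω_pow_three + ω_sq
  obtain ⟨v, hv, hneg⟩ := hg.exists_mem_span_herm_self_neg
  refine eq_zero_of_herm_eq_zero hneg
    (by rw [hg.herm_sum_pow_self hω, hθ, mul_zero, Complex.zero_re]) ?_
  clear hneg
  induction hv using Submodule.span_induction with
  | mem x hx => obtain ⟨k, rfl⟩ := hx; rw [hg.herm_sum_pow hω, hθ, zero_mul]
  | zero => rw [herm_symm, herm_zero_left, map_zero]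
  | add x y _ _ hx hy => rw [herm_add_right, hx, hy, add_zero]
  | smul a x _ hx => rw [herm_smul_right, hx, mul_zero]

theorem sum_range_eq (hg : IsGon g) :
    ∑ j ∈ Finset.range 11, (-ω) ^ j • g (Fin.ofNat 12 j) = ω ^ 2 • g 11 := by
  have hsum := hg.sum_eq_zero
  rw [Fin.sum_univ_castSucc, Fin.val_last, neg_ω_pow_eleven, neg_smul, ← sub_eq_add_neg,
    sub_eq_zero] at hsum
  rw [Finset.sum_range, ← show Fin.last 11 = 11 from rfl, ← hsum]
  exact Finset.sum_congr rfl fun i _ => by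
    congr 2
    exact Fin.ext (Nat.mod_eq_of_lt (by omega))

end IsGon

theorem isLeft_gon_apply (g : SimpleGraph.cycleGraph 12 ↪g incidenceGraph) (i : Fin 12) :
    (g i).isLeft = xor (g 0).isLeft (decide (i.val % 2 = 1)) := by
  have hstep (i : Fin 11) : (g i.succ).isLeft = !(g i.castSucc).isLeft := by
    have hadj : incidenceGraph.Adj (g i.castSucc) (g i.succ) :=
      g.map_rel_iff.2 (SimpleGraph.cycleGraph_adj.2 (.inr (by revert i; decide)))
    rcases hi : g i.castSucc with p | l <;> rcases hj : g i.succ with q | m <;> simp_all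
  have hodd : ∀ i : Fin 11, (!decide (i.castSucc.val % 2 = 1)) = decide (i.succ.val % 2 = 1) := by
    decide
  induction i using Fin.induction with
  | zero => simp
  | succ i ih => rw [hstep, ih, ← Bool.xor_not, hodd]

/-- The sign by which the `i`-th root of a `12`-gon is multiplied to make all consecutive inner
products equal to `θ`, where `b` says whether the root at `0` is a point root. -/
def gonSign (b : Bool) (i : Fin 12) : ℤ := (-1) ^ ((i.val + (!b).toNat) / 2)

/-- The roots of a `12`-gon in the incidence graph, with signs that make all consecutive inner
products equal to `θ`. -/
def gonRoot (g : SimpleGraph.cycleGraph 12 ↪g incidenceGraph) (i : Fin 12) : V :=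
  (gonSign (g 0).isLeft i : ℂ) • root (g i)

theorem gonSign_mul_self (b : Bool) (i : Fin 12) : gonSign b i * gonSign b i = 1 := by
  rw [gonSign, ← mul_pow, neg_one_mul, neg_neg, one_pow]

theorem gonSign_ne_zero (b : Bool) (i : Fin 12) : (gonSign b i : ℂ) ≠ 0 :=
  Int.cast_ne_zero.2 (left_ne_zero_of_mul_eq_one (gonSign_mul_self b i))

theorem root_eq_smul_gonRoot (g : SimpleGraph.cycleGraph 12 ↪g incidenceGraph) (i : Fin 12) :
    root (g i) = (gonSign (g 0).isLeft i : ℂ) • gonRoot g i := by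
  rw [gonRoot, smul_smul, ← Int.cast_mul, gonSign_mul_self, Int.cast_one, one_smul]

theorem isGon_gonRoot (g : SimpleGraph.cycleGraph 12 ↪g incidenceGraph) : IsGon (gonRoot g) := by
  classical
  have hherm (i j : Fin 12) : herm (gonRoot g i) (gonRoot g j) =
      (gonSign (g 0).isLeft i * gonSign (g 0).isLeft j : ℤ) * herm (root (g i)) (root (g j)) := by
    rw [gonRoot, gonRoot, herm_smul_left, herm_smul_right, map_intCast, Int.cast_mul, mul_assoc]
  refine ⟨fun i => ?_, fun i => ?_, fun {i j} hij h h' => ?_⟩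
  · rw [hherm, gonSign_mul_self, Int.cast_one, one_mul, herm_root_self]
  · have hadj : incidenceGraph.Adj (g i) (g (i + 1)) :=
      g.map_rel_iff.2 (SimpleGraph.cycleGraph_adj.2 (.inr (add_sub_cancel_left i 1)))
    have hsign : ∀ (b : Bool) (i : Fin 12), gonSign b i * gonSign b (i + 1) =
        if xor b (decide (i.val % 2 = 1)) then 1 else -1 := by decide
    rw [hherm, hsign, herm_root_root, if_neg hadj.ne, if_pos hadj, ← isLeft_gon_apply]
    split_ifs <;> simp
  · have hadj : ¬ incidenceGraph.Adj (g i) (g j) := by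
      rw [g.map_rel_iff, SimpleGraph.cycleGraph_adj, not_or]
      exact ⟨fun e => h' (by rw [← e]; abel), fun e => h (by rw [← e]; abel)⟩
    rw [hherm, herm_root_root, if_neg (g.injective.ne hij), if_neg hadj, mul_zero]

theorem smul_mem_of_mem_eis {M : Submodule Eis V} {a : ℂ} (ha : a ∈ Eis) {x : V} (hx : x ∈ M) :
    a • x ∈ M :=
  M.smul_mem ⟨a, ha⟩ hx

theorem gonClosed_root_mem (M : Submodule Eis V) (H : Subgroup (V ≃ₗ[ℂ] V)) :
    GonClosed incidenceGraph {v | root v ∈ M ∧ reflection ωUnit (root v) ∈ H} := by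
  intro g hg
  have hω : ω ∈ Eis := ⟨0, 1, by simp⟩
  have hgon := (isGon_gonRoot g).rotate 1
  have hsum := hgon.sum_range_eq
  have hne {j : ℕ} (hj : j < 11) : Fin.ofNat 12 j + 1 ≠ 0 := by interval_cases j <;> decide
  constructor
  · have hroot : root (g 0) = ((gonSign (g 0).isLeft 0 : ℂ) * ω) • (ω ^ 2 • gonRoot g 0) := by
      rw [root_eq_smul_gonRoot, smul_smul, mul_assoc, ← pow_succ', ω_pow_three, mul_one]
    rw [hroot, ← show (11 : Fin 12) + 1 = 0 from rfl, ← hsum]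
    refine smul_mem_of_mem_eis (mul_mem (intCast_mem _ _) hω) (M.sum_mem fun j hj => ?_)
    exact smul_mem_of_mem_eis (pow_mem (neg_mem hω) j) (smul_mem_of_mem_eis (intCast_mem _ _)
      (hg _ (hne (Finset.mem_range.1 hj))).1)
  · have hmem := hgon.isChain.reflection_sum_mem (H := H) fun j hj => by
      rw [gonRoot, reflection_smul _ (gonSign_ne_zero _ _)]
      exact (hg _ (hne (Nat.lt_succ_of_le hj))).2
    rw [hsum, reflection_smul _ (pow_ne_zero 2 ω_ne_zero)] at hmem
    rwa [root_eq_smul_gonRoot, reflection_smul _ (gonSign_ne_zero _ _)]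

theorem root_mem_and_reflection_mem (f : diagram ↪g incidenceGraph) (v : Point ⊕ Line) :
    root v ∈ Submodule.span Eis (Set.range fun i => root (f i)) ∧
      reflection ωUnit (root v) ∈ R f := by
  have := (gonClosed_root_mem (Submodule.span Eis (Set.range fun i => root (f i))) (R f)).eq_univ f
    fun i => ⟨Submodule.subset_span ⟨i, rfl⟩, Subgroup.subset_closure ⟨i, rfl⟩⟩
  exact (Set.eq_univ_iff_forall.1 this) v

namespace IsGon

variable {g : Fin 12 → V}

theorem sum_range_add_sum_range (hg : IsGon g) :
    ∑ j ∈ Finset.range 6, (-ω) ^ j • g (Fin.ofNat 12 j) +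
      ∑ j ∈ Finset.range 6, (-ω) ^ j • g (Fin.ofNat 12 (6 + j)) = 0 := by
  have hterm (j : ℕ) : (-ω) ^ j • g (Fin.ofNat 12 (6 + j)) =
      (-ω) ^ (6 + j) • g (Fin.ofNat 12 (6 + j)) := by
    rw [pow_add, neg_ω_pow_six, one_mul]
  simp only [hterm]
  rw [← Finset.sum_range_add (fun j => (-ω) ^ j • g (Fin.ofNat 12 j)) 6 6, Finset.sum_range,
    ← hg.sum_eq_zero]
  exact Finset.sum_congr rfl fun i _ => by rw [Fin.ofNat_val_eq_self]

theorem eq_of_apply_eq (hg : IsGon g) {A B : V ≃ₗ[ℂ] V}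
    (hA : A ∈ isometriesMod (Submodule.span ℂ (Set.range g)))
    (hB : B ∈ isometriesMod (Submodule.span ℂ (Set.range g)))
    (h : ∀ j ≤ 10, A (g (Fin.ofNat 12 j)) = B (g (Fin.ofNat 12 j))) : A = B := by
  have h_last : A (g 11) = B (g 11) := by
    refine smul_right_injective V (pow_ne_zero 2 ω_ne_zero) ?_
    simp only [← map_smul, ← hg.sum_range_eq, map_sum]
    exact Finset.sum_congr rfl fun j hj => by
      rw [map_smul, map_smul, h j (Nat.le_of_lt_succ (Finset.mem_range.1 hj))]
  have heq : Set.EqOn A B (Submodule.span ℂ (Set.range g)) := by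
    refine LinearMap.eqOn_span' (f := A.toLinearMap) (g := B.toLinearMap) ?_
    rintro _ ⟨i, rfl⟩
    obtain rfl | hi := eq_or_ne i 11
    · exact h_last
    · have := h i.val (by omega)
      rwa [Fin.ofNat_val_eq_self] at this
  obtain ⟨v, hv, hneg⟩ := hg.exists_mem_span_herm_self_neg
  rw [eq_comm, ← inv_mul_eq_one]
  refine eq_one_of_mem_isometriesMod (mul_mem (inv_mem hB) hA) hv hneg fun w hw => ?_
  rw [LinearEquiv.mul_apply, heq hw]
  exact B.symm_apply_apply w

theorem garside_mem_isometriesMod (hg : IsGon g) : garside (fun i => g (Fin.ofNat 12 i)) 5 ∈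
    isometriesMod (Submodule.span ℂ (Set.range g)) :=
  garside_mem fun _ _ =>
    reflection_mem_isometriesMod (hg.herm_self _) (Submodule.subset_span ⟨_, rfl⟩)

theorem mul_garside_apply_five (hg : IsGon g) {h : V ≃ₗ[ℂ] V} {q : ℕ → V} (hq : IsChain q 10)
    (hgq : g (Fin.ofNat 12 5) = -q 5) (h_q : ∀ j ≤ 5, h (q j) = g (Fin.ofNat 12 (6 + j))) :
    (h * garside q 5) (g (Fin.ofNat 12 5)) =
      garside (fun j => g (Fin.ofNat 12 j)) 5 (g (Fin.ofNat 12 5)) := by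
  have hsum := hg.sum_range_add_sum_range
  have hp := hg.isChain.smul_coxeter_apply_self (m := 5) (by decide)
  have hh : (-ω) ^ 5 • h (coxeter q 5 (q 5)) =
      ∑ j ∈ Finset.range 6, (-ω) ^ j • g (Fin.ofNat 12 (6 + j)) := by
    rw [← map_smul, hq.smul_coxeter_apply_self (by decide), map_sum]
    exact Finset.sum_congr rfl fun j hj => by
      rw [map_smul, h_q j (Nat.le_of_lt_succ (Finset.mem_range.1 hj))]
  rw [← hp, ← hh, ← smul_add, smul_eq_zero_iff_right (pow_ne_zero 5 (neg_ne_zero.2 ω_ne_zero)),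
    add_comm, ← neg_eq_iff_add_eq_zero] at hsum
  have hp_self := hg.isChain.garside_apply_self (m := 5) (by decide)
  rw [LinearEquiv.mul_apply, hgq, map_neg, hq.garside_apply_self (by decide), map_neg, hsum, ← hgq]
  exact hp_self.symm

end IsGon

theorem IsChain.mul_garside_apply {p q : ℕ → V} (hp : IsChain p 10) (hq : IsChain q 10)
    (hpq : ∀ j ≤ 10, q j = (-1 : ℂ) ^ j • p (10 - j)) {h : V ≃ₗ[ℂ] V}
    (h_p : ∀ j ≤ 4, h (p j) = (-1 : ℂ) ^ j • p (4 - j))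
    (h_q : ∀ j ≤ 4, h (q j) = (-1 : ℂ) ^ j • q (4 - j)) {j : ℕ} (hj : j ≤ 10) (hj' : j ≠ 5) :
    (h * garside q 5) (p j) = garside p 5 (p j) := by
  have hsign {j : ℕ} (hj : j ≤ 4) : (-1 : ℂ) ^ j * (-1) ^ (4 - j) = 1 := by
    rw [← pow_add, Nat.add_sub_cancel' hj]; norm_num
  have hp_eq : p j = (-1 : ℂ) ^ j • q (10 - j) := by
    rw [hpq _ (by lia), Nat.sub_sub_self hj, smul_smul, ← pow_add, Nat.add_sub_cancel' hj]
    norm_num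
  rw [LinearEquiv.mul_apply]
  rcases hj'.lt_or_gt with hlt | hgt
  · have hj4 := Nat.le_of_lt_succ hlt
    have hfix : garside q 5 (p j) = p j := by
      rw [hp_eq, map_smul, hq.garside_apply_of_lt (by lia) (by lia)]
    rw [hfix, h_p j hj4, hp.garside_apply hj4 (by decide), pow_mul ω 3 3, ω_pow_three, one_pow,
      mul_one]
  · obtain ⟨i, rfl⟩ : ∃ i, j = 10 - i := ⟨10 - j, by lia⟩
    have hi : i ≤ 4 := by lia
    rw [hp.garside_apply_of_lt hgt hj, hp_eq, Nat.sub_sub_self (by lia), map_smul, map_smul,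
      hq.garside_apply hi (by decide), map_smul, h_q _ (by lia), Nat.sub_sub_self hi,
      pow_mul ω 3 3, ω_pow_three, one_pow, mul_one, smul_smul _ _ (q i), hsign hi, one_smul]

/-- Both sides act trivially modulo the span of the `12`-gon, which contains a negative vector, so
they agree if they agree on the span. -/
theorem IsGon.mul_garside_reverse_eq {g : Fin 12 → V} (hg : IsGon g) {h : V ≃ₗ[ℂ] V}
    (hh : h ∈ isometriesMod (Submodule.span ℂ (Set.range g)))
    (h_map : ∀ i, h (g i) = (-1 : ℂ) ^ i.val • g (4 - i)) :
    h * garside (fun j => (-1 : ℂ) ^ (Fin.ofNat 12 j).val • g (10 - Fin.ofNat 12 j)) 5 =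
      garside (fun j => g (Fin.ofNat 12 j)) 5 := by
  have hq := (hg.reverse 10).isChain
  have hmem : garside (fun j => (-1 : ℂ) ^ (Fin.ofNat 12 j).val • g (10 - Fin.ofNat 12 j)) 5 ∈
      isometriesMod (Submodule.span ℂ (Set.range g)) := garside_mem fun _ _ =>
    reflection_mem_isometriesMod ((hg.reverse 10).herm_self _)
      (Submodule.smul_mem _ _ (Submodule.subset_span ⟨_, rfl⟩))
  set q : ℕ → V := fun j => (-1 : ℂ) ^ (Fin.ofNat 12 j).val • g (10 - Fin.ofNat 12 j)
  have q_eq (j : ℕ) (hj : j ≤ 10) : q j = (-1 : ℂ) ^ j • g (Fin.ofNat 12 (10 - j)) := by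
    have : ∀ j ≤ 10, (Fin.ofNat 12 j).val = j ∧ 10 - Fin.ofNat 12 j = Fin.ofNat 12 (10 - j) := by
      decide
    simp only [q, this j hj]
  have h_p (j : ℕ) (hj : j ≤ 4) :
      h (g (Fin.ofNat 12 j)) = (-1 : ℂ) ^ j • g (Fin.ofNat 12 (4 - j)) := by
    have : ∀ j ≤ 4, (Fin.ofNat 12 j).val = j ∧ 4 - Fin.ofNat 12 j = Fin.ofNat 12 (4 - j) := by
      decide
    rw [h_map, (this j hj).1, (this j hj).2]
  have h_q (j : ℕ) (hj : j ≤ 5) : h (q j) = g (Fin.ofNat 12 (6 + j)) := by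
    have : ∀ j ≤ 5, (Fin.ofNat 12 (10 - j)).val + j = 10 ∧
      4 - Fin.ofNat 12 (10 - j) = Fin.ofNat 12 (6 + j) := by decide
    rw [q_eq j (by lia), map_smul, h_map, smul_smul, ← pow_add, add_comm j, (this j hj).1,
      (this j hj).2]
    norm_num
  have h_q_reverse (j : ℕ) (hj : j ≤ 4) : h (q j) = (-1 : ℂ) ^ j • q (4 - j) := by
    rw [h_q j (by lia), q_eq _ (by lia), smul_smul, ← pow_add, Nat.add_sub_cancel' hj,
      show 10 - (4 - j) = 6 + j by lia]
    norm_num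
  refine hg.eq_of_apply_eq (mul_mem hh hmem) hg.garside_mem_isometriesMod fun j hj => ?_
  obtain rfl | hj' := eq_or_ne j 5
  · exact hg.mul_garside_apply_five hq (by rw [q_eq 5 (by decide)]; norm_num) h_q
  · exact hg.isChain.mul_garside_apply hq q_eq h_p h_q_reverse hj hj'

theorem eq_smul_lineRoot_add_sum (l : Line) {x : V} {e : Point → ℂ}
    (h : ∀ p, x.2 p - x.1 * (pointsOn l).indicator 1 p = e p * θ) :
    x = x.1 • lineRoot l + ∑ p, e p • pointRoot p := by
  classical
  ext p
  · simp [lineRoot, pointRoot, Prod.fst_sum]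
  · simpa [lineRoot, pointRoot, Prod.snd_sum, Pi.single_apply, sub_eq_iff_eq_add, add_comm]
      using h p

theorem span_range_root_eq_top (f : diagram ↪g incidenceGraph) :
    Submodule.span ℂ (Set.range fun i => root (f i)) = ⊤ := by
  have hroot (v : Point ⊕ Line) : root v ∈ Submodule.span ℂ (Set.range fun i => root (f i)) :=
    Submodule.span_subset_span Eis ℂ _ (root_mem_and_reflection_mem f v).1
  refine eq_top_iff.2 fun x _ => ?_
  rw [eq_smul_lineRoot_add_sum (proj ones) (x := x) fun p => (div_mul_cancel₀ _ θ_ne_zero).symm]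
  exact add_mem (Submodule.smul_mem _ _ (hroot (.inr _)))
    (Submodule.sum_mem _ fun p _ => Submodule.smul_mem _ _ (hroot (.inl p)))

/-! ### Coordinate permutations as products of reflections -/

theorem permAction_apply (g : PSL(3, ZMod 3)) (x : V) :
    permAction g x = (x.1, fun p => x.2 (g⁻¹ • p)) := rfl

theorem herm_permAction (g : PSL(3, ZMod 3)) (x y : V) :
    herm (permAction g x) (permAction g y) = herm x y := by
  simp only [herm, permAction_apply]
  congr 1
  exact Equiv.sum_comp (MulAction.toPerm g⁻¹) fun p => x.2 p * conj (y.2 p)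

theorem permAction_root (g : SL(3, ZMod 3)) (v : Point ⊕ Line) :
    permAction g (root v) = root (collineation g v) := by
  classical
  rcases v with p | l
  · refine Prod.ext rfl (funext fun q => ?_)
    change (pointRoot p).2 ((g : PSL(3, ZMod 3))⁻¹ • q) = (pointRoot ((g : PSL(3, ZMod 3)) • p)).2 q
    simp only [pointRoot_snd_apply, inv_smul_eq_iff]
  · refine Prod.ext rfl (funext fun q => ?_)
    obtain ⟨p, rfl⟩ := (MulAction.toPerm (g : PSL(3, ZMod 3))).surjective q
    change (lineRoot l).2 ((g : PSL(3, ZMod 3))⁻¹ • (g : PSL(3, ZMod 3)) • p) =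
      (lineRoot (contragredient g • l)).2 ((g : GL (Fin 3) (ZMod 3)) • p)
    simp only [inv_smul_smul, lineRoot_snd_apply, smul_mem_pointsOn_smul]

theorem permAction_conj_mem (f : diagram ↪g incidenceGraph) (g : SL(3, ZMod 3))
    {x : V ≃ₗ[ℂ] V} (hx : x ∈ R f) : permAction g * x * (permAction g)⁻¹ ∈ R f := by
  suffices R f ≤ (R f).comap (MulAut.conj (permAction g)).toMonoidHom from this hx
  refine (Subgroup.closure_le _).2 ?_
  rintro _ ⟨i, rfl⟩
  change permAction g * reflection ωUnit (root (f i)) * (permAction g)⁻¹ ∈ R f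
  rw [mul_reflection_mul_inv (herm_permAction g), permAction_root]
  exact (root_mem_and_reflection_mem f _).2

/-- The matrix of the transposition of the two coordinates other than `c`, with the sign that makes
its determinant `1`. -/
def negSwap (c : Fin 3) : SL(3, ZMod 3) :=
  ⟨of fun i j => if i = Equiv.swap (c + 1) (c + 2) j then -1 else 0, by
    rw [det_fin_three]
    revert c
    decide⟩

/-- The effect of `negSwap c` on homogeneous coordinates, up to sign. -/
def swapCoords (c : Fin 3) (v : NonzeroVec) : NonzeroVec :=
  ⟨v.1 ∘ Equiv.swap (c + 1) (c + 2), fun h =>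
    v.2 ((Equiv.surjective _).injective_comp_right h)⟩

theorem collineation_negSwap_node (c : Fin 3) (v : NonzeroVec ⊕ NonzeroVec) :
    collineation (negSwap c) (node v) = node (v.map (swapCoords c) (swapCoords c)) := by
  have hsmul (w : NonzeroVec) : (negSwap c).1 *ᵥ w.1 = -(swapCoords c w).1 := by
    revert w c
    decide +kernel
  have hcontra : contragredient (negSwap c) = (negSwap c : GL (Fin 3) (ZMod 3)) := by
    have hinv : (negSwap c : GL (Fin 3) (ZMod 3))⁻¹ = negSwap c :=
      inv_eq_of_mul_eq_one_left (Units.ext (by revert c; decide +kernel))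
    refine Units.ext ?_
    change ((negSwap c : GL (Fin 3) (ZMod 3))⁻¹).1ᵀ = (negSwap c).1
    rw [hinv]
    revert c
    decide +kernel
  have hproj (w : NonzeroVec) :
      (negSwap c : GL (Fin 3) (ZMod 3)) • proj w = proj (swapCoords c w) := by
    refine (Projectivization.mk_eq_mk_iff' ..).2 ⟨-1, ?_⟩
    rw [neg_one_smul]
    exact (hsmul w).symm
  rcases v with w | w
  · exact congrArg Sum.inl (hproj w)
  · change Sum.inr (contragredient (negSwap c) • proj w) = _
    rw [hcontra, hproj]
    rfl

instance (v w : NonzeroVec ⊕ NonzeroVec) : Decidable (node v = node w) :=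
  decidable_of_iff (v.isLeft = w.isLeft ∧ (v.elim (·.1) (·.1) = w.elim (·.1) (·.1) ∨
    v.elim (·.1) (·.1) = -w.elim (·.1) (·.1))) <| by
    rcases v with v | v <;> rcases w with w | w <;> simp [node, proj_eq_proj_iff]

/-- The `12`-gon formed by the center and two arms of the standard `Y₅₅₅` diagram and by the point
that closes them up. -/
def armGon (c : Fin 3) : SimpleGraph.cycleGraph 12 ↪g incidenceGraph :=
  embeddingOfAdjIff (fun i => node (![.inl (unitVec (c + 1)), .inr (diffVec (c + 1)), .inl ones,
    .inr (diffVec (c + 2)), .inl (unitVec (c + 2)), .inr (sumVec (c + 2)), .inl (diffVec (c + 2)),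
    .inr (signVec (c + 2)), .inl (sumVec c), .inr (signVec (c + 1)), .inl (diffVec (c + 1)),
    .inr (sumVec (c + 1))] i)) (by revert c; decide +kernel) (by decide +kernel)

theorem collineation_negSwap_armGon (c : Fin 3) (i : Fin 12) :
    collineation (negSwap c) (armGon c i) = armGon c (4 - i) := by
  refine (collineation_negSwap_node c _).trans ?_
  change node _ = node _
  revert i c
  decide +kernel

theorem collineation_negSwap_standardNodes (c : Fin 3) (i : Option (Fin 3 × Fin 5)) :
    collineation (negSwap c) (standardNodes i) = standardNodes i ∨
      ∃ j, standardNodes i = armGon c j := by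
  rw [standardNodes, collineation_negSwap_node]
  change node _ = node _ ∨ ∃ j, node _ = node _
  revert i c
  decide +kernel

theorem permAction_negSwap_gonRoot (c : Fin 3) (i : Fin 12) :
    permAction (negSwap c) (gonRoot (armGon c) i) =
      (-1 : ℂ) ^ i.val • gonRoot (armGon c) (4 - i) := by
  have hsign : ∀ i, gonSign true i * gonSign true (4 - i) = (-1) ^ i.val := by decide
  have hsign' := congrArg (Int.cast (R := ℂ)) (hsign i)
  push_cast at hsign'
  rw [gonRoot, map_smul, permAction_root, collineation_negSwap_armGon, root_eq_smul_gonRoot,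
    smul_smul]
  exact congrArg (· • _) hsign'

theorem permAction_negSwap_mem_isometriesMod (c : Fin 3) : permAction (negSwap c) ∈
    isometriesMod (Submodule.span ℂ (Set.range (gonRoot (armGon c)))) := by
  have hroot (i : Fin 12) :
      root (armGon c i) ∈ Submodule.span ℂ (Set.range (gonRoot (armGon c))) := by
    rw [root_eq_smul_gonRoot]
    exact Submodule.smul_mem _ _ (Submodule.subset_span ⟨i, rfl⟩)
  refine ⟨herm_permAction _, fun x => ?_⟩
  have hx : x ∈ Submodule.span ℂ (Set.range fun i => root (standardEmbedding i)) :=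
    span_range_root_eq_top standardEmbedding ▸ Submodule.mem_top
  induction hx using Submodule.span_induction with
  | mem _ h =>
    obtain ⟨i, rfl⟩ := h
    change permAction (negSwap c) (root (standardNodes i)) - root (standardNodes i) ∈ _
    rw [permAction_root]
    rcases collineation_negSwap_standardNodes c i with h | ⟨j, h⟩
    · rw [h, sub_self]
      exact zero_mem _
    · rw [h, collineation_negSwap_armGon]
      exact sub_mem (hroot _) (hroot _)
  | zero => simp
  | add x y _ _ hx hy => simpa only [map_add, add_sub_add_comm] using add_mem hx hy
  | smul a x _ hx => simpa only [map_smul, smul_sub] using Submodule.smul_mem _ a hx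

theorem permAction_negSwap_mem (c : Fin 3) {H : Subgroup (V ≃ₗ[ℂ] V)}
    (hH : ∀ v, reflection ωUnit (root v) ∈ H) : permAction (negSwap c) ∈ H := by
  have hgon (i : Fin 12) : reflection ωUnit (gonRoot (armGon c) i) ∈ H := by
    rw [gonRoot, reflection_smul _ (gonSign_ne_zero _ _)]
    exact hH _
  rw [eq_mul_inv_of_mul_eq ((isGon_gonRoot (armGon c)).mul_garside_reverse_eq
    (permAction_negSwap_mem_isometriesMod c) (permAction_negSwap_gonRoot c))]
  refine mul_mem (garside_mem fun _ _ => hgon _) (inv_mem (garside_mem fun _ _ => ?_))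
  rw [reflection_smul _ (pow_ne_zero _ (neg_ne_zero.2 one_ne_zero))]
  exact hgon _

section Generation

open SpecialLinearGroup
open scoped commutatorElement

theorem diag2n_neg_one_coe {i j : Fin 3} (hij : i ≠ j) (h : (-1 : ZMod 3) ≠ 0) :
    (diag2n hij (-1) h : Matrix (Fin 3) (Fin 3) (ZMod 3)) =
      diagonal fun m => if m = i then -1 else if m = j then -1 else 1 := by
  rw [diag2n_coe, inv_neg, inv_one]

theorem diag2n_neg_one_eq_commutator {i j k : Fin 3} (hij : i ≠ j) (hik : i ≠ k) (hjk : j ≠ k)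
    (h : (-1 : ZMod 3) ≠ 0) : diag2n hij (-1) h = ⁅negSwap k, diag2n hik (-1) h⁆ := by
  rw [commutatorElement_def, eq_mul_inv_iff_mul_eq, eq_mul_inv_iff_mul_eq]
  apply Subtype.ext
  change (diag2n hij _ h).1 * (diag2n hik _ h).1 * (negSwap k).1 =
    (negSwap k).1 * (diag2n hik _ h).1
  simp only [diag2n_neg_one_coe]
  revert i j k
  decide +kernel

theorem transvection_eq_commutator {i j k : Fin 3} (hij : i ≠ j) (hik : i ≠ k) (hjk : j ≠ k)
    (h : (-1 : ZMod 3) ≠ 0) (a : ZMod 3) :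
    transvection hij a = ⁅diag2n hik (-1) h, transvection hij a⁆ := by
  rw [commutatorElement_def, eq_mul_inv_iff_mul_eq, eq_mul_inv_iff_mul_eq]
  apply Subtype.ext
  change (transvection hij a).1 * (transvection hij a).1 * (diag2n hik _ h).1 =
    (diag2n hik _ h).1 * (transvection hij a).1
  simp only [diag2n_neg_one_coe, transvection_coe]
  revert i j k a
  decide +kernel

theorem eq_top_of_negSwap_mem (N : Subgroup SL(3, ZMod 3)) [N.Normal] (h : ∀ k, negSwap k ∈ N) :
    N = ⊤ := by
  have commutator_mem {x : SL(3, ZMod 3)} (hx : x ∈ N) (y : SL(3, ZMod 3)) : ⁅x, y⁆ ∈ N :=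
    Subgroup.commutator_le_left N ⊤ (Subgroup.commutator_mem_commutator hx (Subgroup.mem_top y))
  have exists_ne : ∀ i j : Fin 3, ∃ k, i ≠ k ∧ j ≠ k := by decide
  have hdiag {i j : Fin 3} (hij : i ≠ j) (h' : (-1 : ZMod 3) ≠ 0) : diag2n hij (-1) h' ∈ N := by
    obtain ⟨k, hik, hjk⟩ := exists_ne i j
    exact diag2n_neg_one_eq_commutator hij hik hjk h' ▸ commutator_mem (h k) _
  refine (Subgroup.eq_top_iff' N).2 fun g => diagonal_transvection_induction' (· ∈ N) g
    (fun i j hij c hc => ?_) (fun i j hij a => ?_) fun _ _ => N.mul_mem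
  · obtain rfl | rfl : c = 1 ∨ c = -1 := by
      revert c
      decide
    · convert N.one_mem
      exact Subtype.ext (by simp [diag2n_coe])
    · exact hdiag hij hc
  · obtain ⟨k, hik, hjk⟩ := exists_ne i j
    exact transvection_eq_commutator hij hik hjk (by decide) a ▸ commutator_mem (hdiag hik _) _

end Generation

theorem L33_le (f : diagram ↪g incidenceGraph) : L33 ≤ R f := by
  let N : Subgroup SL(3, ZMod 3) :=
    (R f).comap (permAction.comp (QuotientGroup.mk' (Subgroup.center SL(3, ZMod 3))))
  have hN (g : SL(3, ZMod 3)) : g ∈ N ↔ permAction (g : PSL(3, ZMod 3)) ∈ R f := Iff.rfl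
  have : N.Normal := ⟨fun n hn g => by
    have := permAction_conj_mem f g ((hN n).1 hn)
    rwa [← map_inv, ← map_mul, ← map_mul] at this⟩
  have htop : N = ⊤ := eq_top_of_negSwap_mem N fun k =>
    permAction_negSwap_mem k fun v => (root_mem_and_reflection_mem f v).2
  rintro _ ⟨g, rfl⟩
  obtain ⟨g, rfl⟩ := QuotientGroup.mk_surjective g
  rw [← hN, htop]
  exact Subgroup.mem_top g

/-! ### The line code and the lattice -/

theorem sum_point {A : Type*} [AddCommMonoid A] (F : Point → A) :
    ∑ p, F p = F (proj ones) + ∑ a, (F (proj (unitVec a)) + F (proj (diffVec a)) +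
      F (proj (sumVec a)) + F (proj (signVec a))) := by
  let e : Option (Fin 3 × Fin 4) → NonzeroVec := fun i =>
    i.elim ones fun j => ![unitVec j.1, diffVec j.1, sumVec j.1, signVec j.1] j.2
  have he : Function.Bijective (proj ∘ e) := by
    refine ⟨fun i j h => ?_, fun p => ?_⟩
    · rw [Function.comp_apply, Function.comp_apply, proj_eq_proj_iff] at h
      revert i j
      decide +kernel
    · rcases exists_proj_eq_of_standard p with rfl | ⟨a, rfl | rfl | rfl | rfl⟩
      exacts [⟨none, rfl⟩, ⟨some (a, 0), rfl⟩, ⟨some (a, 1), rfl⟩, ⟨some (a, 2), rfl⟩,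
        ⟨some (a, 3), rfl⟩]
  rw [← he.sum_comp, Fintype.sum_option, Fintype.sum_prod_type]
  simp only [Fin.sum_univ_four]
  rfl

theorem lineWord_proj_proj (l v : NonzeroVec) :
    lineWord (proj l) (proj v) = if v.1 ⬝ᵥ l.1 = 0 then 1 else 0 := by
  classical
  simp only [lineWord, Set.indicator_apply, proj_mem_pointsOn_proj, Pi.one_apply]

theorem lineWord_mem_lineCode (l : Line) : lineWord l ∈ lineCode := by
  classical
  have hsum (m : Line) : ∑ p, lineWord l p * lineWord m p = 1 :=
    (sum_indicator_pointsOn_mul l m).trans (ite_eq_right_iff.2 fun _ => by decide)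
  intro c hc
  induction hc using Submodule.span_induction with
  | mem c hc =>
    obtain ⟨m, m', rfl⟩ := hc
    simp only [Pi.sub_apply, mul_sub, Finset.sum_sub_distrib, hsum, sub_self]
  | zero => simp
  | add x y _ _ hx hy => simp only [Pi.add_apply, mul_add, Finset.sum_add_distrib, hx, hy, add_zero]
  | smul a x _ hx =>
    simp only [Pi.smul_apply, smul_eq_mul, mul_left_comm _ a, ← Finset.mul_sum, hx, mul_zero]

theorem sum_mul_lineWord_eq {w : Point → ZMod 3} (hw : w ∈ lineCode) (l m : Line) :
    ∑ p, w p * lineWord l p = ∑ p, w p * lineWord m p := by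
  have := hw _ (Submodule.subset_span ⟨l, m, rfl⟩)
  simpa only [Pi.sub_apply, mul_sub, Finset.sum_sub_distrib, sub_eq_zero] using this

theorem eq_zero_of_mem_lineCode {w : Point → ZMod 3} (hw : w ∈ lineCode)
    (h_ones : w (proj ones) = 0) (h_unit : ∀ a, w (proj (unitVec a)) = 0)
    (h_diff : ∀ a, w (proj (diffVec a)) = 0) : w = 0 := by
  -- All line sums of `w` are `0`, because `w` vanishes on the line `ones`.
  have hline (l : NonzeroVec) :
      ∑ a, (w (proj (sumVec a)) * (if (sumVec a).1 ⬝ᵥ l.1 = 0 then 1 else 0) +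
        w (proj (signVec a)) * (if (signVec a).1 ⬝ᵥ l.1 = 0 then 1 else 0)) = 0 := by
    have e_sum : ∀ a, (sumVec a).1 ⬝ᵥ ones.1 ≠ 0 := by decide
    have e_sign : ∀ a, (signVec a).1 ⬝ᵥ ones.1 ≠ 0 := by decide
    simpa only [sum_point, lineWord_proj_proj, h_ones, h_unit, h_diff, e_sum, e_sign, if_false,
      mul_zero, zero_mul, zero_add, Finset.sum_const_zero]
      using sum_mul_lineWord_eq hw (proj l) (proj ones)
  have h_sum (c : Fin 3) : w (proj (sumVec c)) + w (proj (signVec c)) = 0 := by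
    have e_sum : ∀ a c, (sumVec a).1 ⬝ᵥ (diffVec c).1 = 0 ↔ a = c := by decide
    have e_sign : ∀ a c, (signVec a).1 ⬝ᵥ (diffVec c).1 = 0 ↔ a = c := by decide
    simpa [e_sum, e_sign, Finset.sum_add_distrib] using hline (diffVec c)
  have h_sign (c : Fin 3) : w (proj (signVec c)) = 0 := by
    have e_sum : ∀ a c, (sumVec a).1 ⬝ᵥ (sumVec c).1 ≠ 0 := by decide
    have e_sign : ∀ a c, (if (signVec a).1 ⬝ᵥ (sumVec c).1 = 0 then 1 else 0) =
        1 - if a = c then (1 : ZMod 3) else 0 := by decide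
    have h_eq (c : Fin 3) : ∑ a, w (proj (signVec a)) = w (proj (signVec c)) := by
      simpa [e_sum, e_sign, mul_sub, Finset.sum_sub_distrib, sub_eq_zero] using hline (sumVec c)
    rw [← h_eq c, Finset.sum_congr rfl fun a _ => (h_eq a).symm, Finset.sum_const, nsmul_eq_mul]
    exact zero_mul _
  funext p
  rcases exists_proj_eq_of_standard p with rfl | ⟨a, rfl | rfl | rfl | rfl⟩
  exacts [h_ones, h_unit a, h_diff a, (add_zero _).symm.trans (h_sign a ▸ h_sum a), h_sign a]

theorem lineCode_le_span_lineWord :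
    lineCode ≤ Submodule.span (ZMod 3) (Set.range lineWord) := by
  intro w hw
  -- `u` agrees with `w` at `ones`, at `unitVec a` and at `diffVec a`.
  let α (a : Fin 3) := w (proj (unitVec a)) - if a = 0 then w (proj ones) else 0
  let u : Point → ZMod 3 := w (proj ones) • lineWord (proj (diffVec 0)) +
    ∑ a, (α a • lineWord (proj (sumVec a)) +
      (w (proj (diffVec a)) - α a) • lineWord (proj (signVec a)))
  have hu {M : Submodule (ZMod 3) (Point → ZMod 3)} (hM : ∀ l, lineWord l ∈ M) : u ∈ M :=
    add_mem (M.smul_mem _ (hM _))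
      (M.sum_mem fun _ _ => add_mem (M.smul_mem _ (hM _)) (M.smul_mem _ (hM _)))
  have h : w - u = 0 := by
    refine eq_zero_of_mem_lineCode (sub_mem hw (hu lineWord_mem_lineCode)) ?_ (fun a => ?_)
      fun a => ?_
    · have e_diff : ones.1 ⬝ᵥ (diffVec 0).1 = 0 := by decide
      have e_sum : ∀ a, ones.1 ⬝ᵥ (sumVec a).1 ≠ 0 := by decide
      have e_sign : ∀ a, ones.1 ⬝ᵥ (signVec a).1 ≠ 0 := by decide
      simp [u, lineWord_proj_proj, e_diff, e_sum, e_sign]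
    · have e_diff : ∀ a, (unitVec a).1 ⬝ᵥ (diffVec 0).1 = 0 ↔ a = 0 := by decide
      have e_sum : ∀ a b, (unitVec a).1 ⬝ᵥ (sumVec b).1 = 0 ↔ a = b := by decide
      have e_sign : ∀ a b, (unitVec a).1 ⬝ᵥ (signVec b).1 ≠ 0 := by decide
      simp [u, α, lineWord_proj_proj, e_diff, e_sum, e_sign]
    · have e_diff : ∀ a, (diffVec a).1 ⬝ᵥ (diffVec 0).1 ≠ 0 := by decide
      have e_sum : ∀ a b, (diffVec a).1 ⬝ᵥ (sumVec b).1 = 0 ↔ a = b := by decide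
      have e_sign : ∀ a b, (diffVec a).1 ⬝ᵥ (signVec b).1 = 0 ↔ a = b := by decide
      simp [u, lineWord_proj_proj, e_diff, e_sum, e_sign, Finset.sum_add_distrib]
  rw [sub_eq_zero.1 h]
  exact hu fun l => Submodule.subset_span ⟨l, rfl⟩

theorem CongrTheta.refl (x : ℂ) : CongrTheta x x := ⟨0, Eis.zero_mem, by ring⟩

theorem pointRoot_mem (p : Point) : pointRoot p ∈ L := by
  classical
  refine ⟨Eis.zero_mem, fun q => ?_, ⟨-1, Eis.neg_mem Eis.one_mem, ?_⟩, 0, lineCode.zero_mem,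
    fun q => ?_⟩
  · rw [pointRoot_snd_apply]
    split_ifs
    exacts [θ_mem, Eis.zero_mem]
  · simp [pointRoot]
  · rw [pointRoot_snd_apply]
    split_ifs
    · exact ⟨1, Eis.one_mem, by simp⟩
    · exact ⟨0, Eis.zero_mem, by simp⟩

theorem lineRoot_mem (l : Line) : lineRoot l ∈ L := by
  classical
  refine ⟨Eis.one_mem, fun q => ?_, ?_, lineWord l, lineWord_mem_lineCode l, fun q => ?_⟩
  · rw [lineRoot_snd_apply]
    split_ifs
    exacts [Eis.one_mem, Eis.zero_mem]
  · have hsum : ∑ p, (lineRoot l).2 p = 4 := by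
      simpa only [lineRoot, Set.indicator_apply, Pi.one_apply, ite_zero_mul_ite_zero, and_self,
        mul_one, if_true] using sum_indicator_pointsOn_mul (A := ℂ) l l
    rw [hsum]
    exact_mod_cast congrTheta_intCast (m := 1) (n := 4) (by decide)
  · rw [lineRoot_snd_apply, lineWord, Set.indicator_apply]
    split_ifs
    · simpa [ZMod.val_one] using CongrTheta.refl 1
    · simpa using CongrTheta.refl 0

theorem root_mem (v : Point ⊕ Line) : root v ∈ L :=
  v.rec pointRoot_mem lineRoot_mem

theorem mem_of_congrTheta_zero {M : Submodule Eis V} (hM : ∀ v, root v ∈ M) {x : V}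
    (h₁ : CongrTheta x.1 0) (h₂ : ∀ p, CongrTheta (x.2 p) 0) : x ∈ M := by
  obtain ⟨e, he, h₁⟩ := h₁
  choose e' he' h₂ using h₂
  rw [sub_zero] at h₁
  simp only [sub_zero] at h₂
  let l : Line := proj ones
  have hind (p : Point) : (pointsOn l).indicator (1 : Point → ℂ) p ∈ Eis :=
    (lineRoot_mem l).2.1 p
  rw [eq_smul_lineRoot_add_sum l (x := x)
    (e := fun p => e' p - e * (pointsOn l).indicator 1 p) fun p => by rw [h₁, h₂]; ring]
  refine add_mem (smul_mem_of_mem_eis (h₁ ▸ mul_mem θ_mem he) (hM (.inr l)))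
    (M.sum_mem fun p _ => smul_mem_of_mem_eis ?_ (hM (.inl p)))
  exact sub_mem (he' p) (mul_mem he (hind p))

theorem congrTheta_sum {ι : Type*} (s : Finset ι) {x y : ι → ℂ}
    (h : ∀ i ∈ s, CongrTheta (x i) (y i)) : CongrTheta (∑ i ∈ s, x i) (∑ i ∈ s, y i) := by
  classical
  induction s using Finset.induction_on with
  | empty => exact .refl 0
  | insert i s hi ih =>
    rw [Finset.sum_insert hi, Finset.sum_insert hi]
    exact (h i (Finset.mem_insert_self i s)).add (ih fun j hj => h j (Finset.mem_insert_of_mem hj))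

theorem mem_of_mem_L_of_congrTheta_zero {M : Submodule Eis V} (hM : ∀ v, root v ∈ M) {x : V}
    (hx : x ∈ L) (h : ∀ p, CongrTheta (x.2 p) 0) : x ∈ M :=
  mem_of_congrTheta_zero hM
    (hx.2.2.1.trans (by simpa using congrTheta_sum Finset.univ fun p _ => h p)) h

theorem exists_congrTheta_sum_smul_lineRoot {x : V} (hx : x ∈ L) :
    ∃ a : Line → ℕ, ∀ p, CongrTheta (x.2 p) ((∑ l, (a l : ℂ) • lineRoot l : V).2 p) := by
  classical
  obtain ⟨c, hc, hxc⟩ := hx.2.2.2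
  obtain ⟨a, rfl⟩ := (Submodule.mem_span_range_iff_exists_fun _).1 (lineCode_le_span_lineWord hc)
  refine ⟨fun l => (a l).val, fun p => (hxc p).trans ?_⟩
  have hval : (∑ l, ((a l).val : ℂ) • lineRoot l : V).2 p =
      (∑ l, (a l).val * (lineWord l p).val : ℕ) := by
    simp [lineRoot, lineWord, Prod.snd_sum, Set.indicator_apply, apply_ite, ZMod.val_one]
  rw [hval]
  exact_mod_cast congrTheta_intCast (m := (((∑ l, a l • lineWord l) p).val : ℕ))
    (n := (∑ l, (a l).val * (lineWord l p).val : ℕ)) (by simp)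

theorem le_of_forall_root_mem {M : Submodule Eis V} (hM : ∀ v, root v ∈ M) : L ≤ M := by
  intro x hx
  obtain ⟨a, ha⟩ := exists_congrTheta_sum_smul_lineRoot hx
  have hsub (p : Point) : CongrTheta ((x - ∑ l, (a l : ℂ) • lineRoot l).2 p) 0 :=
    let ⟨e, he, h⟩ := ha p
    ⟨e, he, by rwa [sub_zero, Prod.snd_sub, Pi.sub_apply]⟩
  have hmem {N : Submodule Eis V} (hN : ∀ v, root v ∈ N) : ∑ l, (a l : ℂ) • lineRoot l ∈ N :=
    N.sum_mem fun l _ => smul_mem_of_mem_eis (natCast_mem Eis _) (hN (.inr l))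
  rw [← sub_add_cancel x (∑ l, (a l : ℂ) • lineRoot l)]
  exact add_mem (mem_of_mem_L_of_congrTheta_zero hM (sub_mem hx (hmem root_mem)) hsub) (hmem hM)

theorem span_root_eq (f : diagram ↪g incidenceGraph) :
    Submodule.span Eis (Set.range fun i => root (f i)) = L :=
  le_antisymm (Submodule.span_le.2 (Set.range_subset_iff.2 fun _ => root_mem _))
    (le_of_forall_root_mem fun v => (root_mem_and_reflection_mem f v).1)

theorem eq_ωUnit_or_eq_inv_of_orderOf_eq_three {ζ : ℂˣ} (hζ : orderOf ζ = 3) :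
    ζ = ωUnit ∨ ζ = ωUnit⁻¹ := by
  have h3 : (ζ : ℂ) ^ 3 = 1 := by
    rw [← Units.val_pow_eq_pow_val, ← hζ, pow_orderOf_eq_one, Units.val_one]
  have h1 : (ζ : ℂ) - 1 ≠ 0 := fun h => by
    simp [show ζ = 1 from Units.ext (sub_eq_zero.1 h)] at hζ
  have h : ((ζ : ℂ) - ω) * (ζ + 1 + ω) = 0 :=
    mul_left_cancel₀ h1 (by linear_combination h3 - ((ζ : ℂ) - 1) * ω_sq)
  refine (mul_eq_zero.1 h).imp (fun h => Units.ext (sub_eq_zero.1 h)) fun h => ?_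
  refine eq_inv_of_mul_eq_one_left (Units.ext ?_)
  change (ζ : ℂ) * ω = 1
  linear_combination ω * h - ω_sq

theorem reflection_mem (f : diagram ↪g incidenceGraph) (v : Point ⊕ Line) {ζ : ℂˣ}
    (hζ : orderOf ζ = 3) : reflection ζ (root v) ∈ R f := by
  have h := (root_mem_and_reflection_mem f v).2
  rcases eq_ωUnit_or_eq_inv_of_orderOf_eq_three hζ with rfl | rfl
  · exact h
  · rw [← reflection_inv]
    exact inv_mem h

end Y555

end

/-- The `Y₅₅₅` diagram embeds (as an induced subgraph) in the incidence graph `Δ` of `P²(𝔽₃)`, and for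
every such embedding the 16 corresponding point and line roots span `L` over `ℤ[ω]`, and the group
`R` generated by their `ω`-reflections contains both triflections in each of the 26 point and line
roots and contains `L₃(3)`. -/
theorem lemma6 :
    Nonempty (Y555.diagram ↪g Y555.incidenceGraph) ∧
    ∀ f : Y555.diagram ↪g Y555.incidenceGraph,
      Submodule.span Y555.Eis (Set.range fun i => Y555.root (f i)) = Y555.L ∧
      (∀ (v : Y555.Point ⊕ Y555.Line) (ζ : ℂˣ), orderOf ζ = 3 →
        Y555.reflection ζ (Y555.root v) ∈ Y555.R f) ∧
      Y555.L33 ≤ Y555.R f :=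
  ⟨⟨Y555.standardEmbedding⟩, fun f => ⟨Y555.span_root_eq f,
    fun v _ hζ => Y555.reflection_mem f v hζ, Y555.L33_le f⟩⟩
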